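/- Let $K$ be a field with a (possibly trivial) non-Archimedean valuation $\mathrm{val}:K\to\mathbb{T}=\mathbb{R}\cup\{\infty\}$, and let $n\ge 0$. A matrix is weakly monomial if each of its rows has at most one nonzero entry. To a weakly monomial $M\in K^{n\times n}$ associate the map $f=(f_1,f_2):[n]\cup\{o\}\to([n]\cup\{o\})\times\mathbb{T}$ with $f(i)=(j,\mathrm{val}(M_{ij}))$ if $M_{ij}\neq 0$, and $f(i)=(o,\infty)$ if $i=o$ or the $i$-th row is zero. For a valuated matroid $\mu$ on $[n]$, let $\mu_o$ be $\mu$ with a loop $o$ added, let $S=f_1([n]\cup\{o\})$, and let $f^{-1}(\mu)$ be the valuated matroid, of rank equal to the rank of $S$ in $\mu_o$, given by $f^{-1}(\mu)(B)=\mu_o|_{S}(f_1(B))+\sum_{i\in B}f_2(i)$ (valuated matroids are considered up to adding a real constant). For a valuated matroid $\nu$ on $[n]$, $f:\nu\to\mu$ is called an affine morphism of valuated matroids if $f^{-1}(\mu)|_{[n]}$ is a valuated matroid quotient of $\nu$, written $f^{-1}(\mu)\twoheadleftarrow\nu$. It is called a realizable affine morphism if moreover $\mu$, $\nu$ and $f^{-1}(\mu)$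 are realizable over $K$ and the quotient $f^{-1}(\mu)\twoheadleftarrow\nu$ is realizable over $K$, i.e. there are linear subspaces $L_1\subseteq L_2\subseteq K^n$ whose valuated matroids (valuations of the Plücker coordinates) are $f^{-1}(\mu)$ and $\nu$. Write $\overline{\operatorname{trop}}(\mu)\subseteq\mathbb{P}(\mathbb{T}^n)$ for the tropical linear space of $\mu$, $\overline{\operatorname{trop}}(L)$ for the tropicalization of a linear subspace $L\subseteq K^n$ (the intersection of the tropical hyperplanes of all linear forms vanishing on $L$), and $\mathrm{val}(M)\odot X$ for the set of points $[\mathrm{val}(M)\odot x]$ with $[x]\in X$ and $\mathrm{val}(M)\odot x\ne(\infty,\dots,\infty)$. (1) Let $M\in K^{n\times n}$ be weakly monomial with associated map $f$, and let $\mu$ and $\nu$ be valuated matroids on $[n]$ of ranks $r$ and $s$. Then $\mathrm{val}(M)\odot\overline{\operatorname{trop}}(\mu)\subseteq\overline{\operatorname{trop}}(\nu)$ if and only if $f:\nu\to\mu$ is an affine morphism of valuated matroids. (2) In the situation of (1), call the containment $\mathrm{val}(M)\odot\overline{\operatorname{trop}}(\mu)\subseteq\overline{\operatorname{trop}}(\nu)$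 realizable if $\overline{\operatorname{trop}}(\mu)=\overline{\operatorname{trop}}(U)$ for some linear subspace $U\subseteq K^n$, and there are linear subspaces $L_1\subseteq L_2\subseteq K^n$ with $\overline{\operatorname{trop}}(L_1)=\mathrm{val}(M)\odot\overline{\operatorname{trop}}(\mu)$ and $\overline{\operatorname{trop}}(L_2)=\overline{\operatorname{trop}}(\nu)$. The containment is realizable if and only if $f:\nu\to\mu$ is a realizable affine morphism of valuated matroids. This is the case whenever there are linear subspaces $U,W\subseteq K^n$ with $\overline{\operatorname{trop}}(U)=\overline{\operatorname{trop}}(\mu)$, $\overline{\operatorname{trop}}(W)=\overline{\operatorname{trop}}(\nu)$ and $M\cdot U\subseteq W$. (3) Let $Q$ be a finite quiver with vertex set $V$, let $R$ be a representation of $Q$ that assigns $K^n$ to every vertex and a weakly monomial matrix $M_\alpha\in K^{n\times n}$ to every arrow $\alpha:s(\alpha)\to t(\alpha)$, and let $\boldsymbol\mu=(\mu_i)_{i\in V}$ be valuated matroids on $[n]$ of ranks $\mathbf d=(d_i)_{i\in V}$. Let the quiver Dressian $\operatorname{QDr}(R,\mathbf d;n)\subseteq\prod_{i\in V}\mathbb{P}(\mathbb{T}^{\binom{n}{d_i}})$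 be the tropical prevariety cut out by the tropicalizations of the Grassmann-Plücker relations of all vertices and of the quiver Plücker relations $$\sum_{j\in[n]\setminus I,\ i\in J}\pm (M_\alpha)_{ij}\,p_{I\cup j}\,q_{J\setminus i},\qquad |I|=d_{s(\alpha)}-1,\ |J|=d_{t(\alpha)}+1,$$ of all arrows $\alpha$, where $p$ and $q$ are separate sets of Plücker variables, evaluated at the points of the source and of the target of $\alpha$. The following are equivalent: (a) $\boldsymbol\mu\in\operatorname{QDr}(R,\mathbf d;n)$; (b) $\mathrm{val}(M_\alpha)\odot\overline{\operatorname{trop}}(\mu_{s(\alpha)})\subseteq\overline{\operatorname{trop}}(\mu_{t(\alpha)})$ for every arrow $\alpha$; (c) for every arrow $\alpha$, the map associated to $M_\alpha$ is an affine morphism of valuated matroids $\mu_{t(\alpha)}\to\mu_{s(\alpha)}$. -/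

import Mathlib

/-- The minimum of the finite or infinite family `a` of tropical numbers is attained at least twice.
The minimum `∞` counts as attained twice. -/
def MinTwice {ι : Type*} (a : ι → WithTop ℝ) : Prop :=
  (∀ i, a i = ⊤) ∨ ∃ i j, i ≠ j ∧ a i = a j ∧ ∀ k, a i ≤ a k

/-! ### Tropical projective space -/

/-- Vectors over the tropical numbers `𝕋 = ℝ ∪ {∞}` that are not constantly `∞`. -/
def TropVec (ι : Type*) : Type _ := {x : ι → WithTop ℝ // ∃ i, x i ≠ ⊤}

/-- Two tropical vectors are identified when they differ by a real multiple of `(1, …, 1)`. -/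
instance TropVec.setoid (ι : Type*) : Setoid (TropVec ι) where
  r x y := ∃ c : ℝ, ∀ i, x.1 i = y.1 i + (c : WithTop ℝ)
  iseqv :=
    { refl := fun x => ⟨0, fun i => by simp⟩
      symm := by
        rintro x y ⟨c, h⟩
        refine ⟨-c, fun i => ?_⟩
        rw [h i, add_assoc, ← WithTop.coe_add, add_neg_cancel, WithTop.coe_zero, add_zero]
      trans := by
        rintro x y z ⟨c, h⟩ ⟨d, h'⟩
        refine ⟨d + c, fun i => ?_⟩
        rw [h i, h' i, add_assoc, ← WithTop.coe_add] }

/-- The tropical projective space `ℙ(𝕋^ι)`. -/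
def TropProj (ι : Type*) : Type _ := Quotient (TropVec.setoid ι)

/-- The point of tropical projective space represented by a tropical vector. -/
def TropVec.mk {ι : Type*} (x : TropVec ι) : TropProj ι := Quotient.mk _ x

/-- Tropical matrix-vector multiplication, `(P ⊙ x)_i = min_j (P_{ij} + x_j)`. -/
def tropMulVec {m n : Type*} [Fintype n] (P : Matrix m n (WithTop ℝ)) (x : n → WithTop ℝ) :
    m → WithTop ℝ :=
  fun i => Finset.univ.inf fun j => P i j + x j

/-- The pointwise product `P ⊙ X` for `X ⊆ ℙ(𝕋^n)`: the points `[P ⊙ x]`, `[x] ∈ X`, wherever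
`P ⊙ x` is not constantly `∞`. -/
def tropImage {m n : Type*} [Fintype n] (P : Matrix m n (WithTop ℝ)) (X : Set (TropProj n)) :
    Set (TropProj m) :=
  {q | ∃ (x : TropVec n) (y : TropVec m), x.mk ∈ X ∧ y.1 = tropMulVec P x.1 ∧ q = y.mk}

/-! ### Valuated matroids -/

/-- A valuated matroid of rank `r` on the ground set `E`. The valuation is a function on all subsets
of `E` that is `∞` away from the subsets of cardinality `r`. -/
structure ValuatedMatroid (E : Type*) [DecidableEq E] (r : ℕ) where
  toFun : Finset E → WithTop ℝ
  top_of_card_ne : ∀ B, B.card ≠ r → toFun B = ⊤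
  exists_base : ∃ B, toFun B ≠ ⊤
  exchange : ∀ I J : Finset E, I.card = r → J.card = r → ∀ i ∈ I \ J, ∃ j ∈ J \ I,
    toFun (insert j (I.erase i)) + toFun (insert i (J.erase j)) ≤ toFun I + toFun J

namespace ValuatedMatroid

variable {E : Type*} [DecidableEq E] {r s : ℕ}

/-- The valuated matroid, up to equivalence, as a point of the tropical projective space with
coordinates indexed by the `r`-subsets of `E`. -/
def point (μ : ValuatedMatroid E r) : TropProj {B : Finset E // B.card = r} :=
  TropVec.mk ⟨fun B => μ.toFun B.1, by
    obtain ⟨B, hB⟩ := μ.exists_base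
    exact ⟨⟨B, by_contra fun h => hB (μ.top_of_card_ne B h)⟩, hB⟩⟩

/-- `μ.IsQuotient ν`: the valuated matroid `μ` is a valuated matroid quotient of `ν`, `μ ↞ ν`. -/
def IsQuotient (μ : ValuatedMatroid E r) (ν : ValuatedMatroid E s) : Prop :=
  r ≤ s ∧ ∀ I J : Finset E, I.card = r → J.card = s → ∀ i ∈ I \ J, ∃ j ∈ J \ I,
    μ.toFun (insert j (I.erase i)) + ν.toFun (insert i (J.erase j)) ≤ μ.toFun I + ν.toFun J

/-- The vector `C_μ(I)`, for `I` of cardinality `r + 1`. -/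
def circuitVec (μ : ValuatedMatroid E r) (I : Finset E) : E → WithTop ℝ :=
  fun i => if i ∈ I then μ.toFun (I.erase i) else ⊤

/-- (Representatives of) the valuated circuits of `μ`. -/
def circuits (μ : ValuatedMatroid E r) : Set (E → WithTop ℝ) :=
  {C | ∃ I : Finset E, I.card = r + 1 ∧ C = μ.circuitVec I ∧ ∃ i, C i ≠ ⊤}

/-- The tropical linear space of `μ` in `ℙ(𝕋^E)`: the intersection of the tropical hyperplanes
`V(⨁ C_i ⊙ x_i)` over the valuated circuits `C`. -/
def trop (μ : ValuatedMatroid E r) : Set (TropProj E) :=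
  {p | ∃ x : TropVec E, p = x.mk ∧ ∀ C ∈ μ.circuits, MinTwice fun i => C i + x.1 i}

/-- The pointed valuated matroid `μ_o`: a loop `o` (here `none`) is added to the ground set. -/
def pointed (μ : ValuatedMatroid E r) : ValuatedMatroid (Option E) r where
  toFun B := if none ∈ B then ⊤ else μ.toFun B.eraseNone
  top_of_card_ne B hB := by
    split_ifs with h
    · rfl
    · refine μ.top_of_card_ne _ ?_
      rwa [Finset.card_eraseNone_of_not_mem h]
  exists_base := by
    obtain ⟨B, hB⟩ := μ.exists_base
    exact ⟨B.map Function.Embedding.some, by simpa using hB⟩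
  exchange I J hI hJ i hi := by
    have hne : (J \ I).Nonempty := by
      rw [← Finset.card_pos, Finset.card_sdiff_comm (hJ.trans hI.symm)]
      exact Finset.card_pos.2 ⟨i, hi⟩
    by_cases hIo : none ∈ I
    · obtain ⟨j, hj⟩ := hne
      exact ⟨j, hj, by simp [hIo]⟩
    by_cases hJo : none ∈ J
    · obtain ⟨j, hj⟩ := hne
      exact ⟨j, hj, by simp [hJo]⟩
    cases i with
    | none => simp [hIo] at hi
    | some a =>
      obtain ⟨b, hb, h⟩ := μ.exchange I.eraseNone J.eraseNone
        (by rwa [Finset.card_eraseNone_of_not_mem hIo])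
        (by rwa [Finset.card_eraseNone_of_not_mem hJo]) a (by simpa using hi)
      refine ⟨some b, by simpa using hb, ?_⟩
      have e₁ : (insert (some b) (I.erase (some a))).eraseNone
          = insert b (I.eraseNone.erase a) := by ext x; simp
      have e₂ : (insert (some a) (J.erase (some b))).eraseNone
          = insert a (J.eraseNone.erase b) := by ext x; simp
      simpa [hIo, hJo, e₁, e₂] using h

/-- Removing a loop `o` from the ground set `E ∪ {o}`, that is, the restriction to `E`. -/
def unpoint (μ : ValuatedMatroid (Option E) r) (h : ∀ B, none ∈ B → μ.toFun B = ⊤) :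
    ValuatedMatroid E r where
  toFun B := μ.toFun (B.map Function.Embedding.some)
  top_of_card_ne B hB := μ.top_of_card_ne _ (by simpa using hB)
  exists_base := by
    obtain ⟨B, hB⟩ := μ.exists_base
    refine ⟨B.eraseNone, ?_⟩
    rwa [Finset.map_some_eraseNone, Finset.erase_eq_of_notMem fun hn => hB (h B hn)]
  exchange I J hI hJ i hi := by
    obtain ⟨j, hj, hle⟩ := μ.exchange (I.map Function.Embedding.some)
      (J.map Function.Embedding.some) (by simpa using hI) (by simpa using hJ) (some i)
      (by simpa using hi)
    cases j with
    | none => simp at hj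
    | some b =>
      refine ⟨b, by simpa using hj, ?_⟩
      have e₁ : (insert b (I.erase i)).map Function.Embedding.some
          = insert (some b) ((I.map Function.Embedding.some).erase (some i)) := by
        ext x; cases x <;> simp
      have e₂ : (insert i (J.erase b)).map Function.Embedding.some
          = insert (some i) ((J.map Function.Embedding.some).erase (some b)) := by
        ext x; cases x <;> simp
      rw [e₁, e₂]
      exact hle

section Restriction

variable [Fintype E]

open scoped Classical in
/-- The rank of `S` in the underlying matroid of `μ`: the largest size of `B ∩ S`, `B` a basis. -/
noncomputable def rk (μ : ValuatedMatroid E r) (S : Finset E) : ℕ :=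
  (Finset.univ.filter fun B => μ.toFun B ≠ ⊤).sup fun B => (B ∩ S).card

theorem exists_base_rk (μ : ValuatedMatroid E r) (S : Finset E) :
    ∃ B, μ.toFun B ≠ ⊤ ∧ (B ∩ S).card = μ.rk S := by
  classical
  obtain ⟨B₀, hB₀⟩ := μ.exists_base
  obtain ⟨B, hB, h⟩ := Finset.exists_mem_eq_sup (Finset.univ.filter fun B => μ.toFun B ≠ ⊤)
    ⟨B₀, by simpa using hB₀⟩ fun B => (B ∩ S).card
  refine ⟨B, by simpa using hB, ?_⟩
  rw [rk]
  convert h.symm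

/-- A set `X` disjoint from `S` that completes the bases of the restriction to `S` to bases of `μ`.
-/
noncomputable def completion (μ : ValuatedMatroid E r) (S : Finset E) : Finset E :=
  (μ.exists_base_rk S).choose \ S

/-- The restriction `μ|_S`, of rank `rk S`, given by `B ↦ μ(B ∪ X)` for `B ⊆ S`. A different
completion `X` changes it by an additive constant only. It is kept on the ground set `E`, with value
`∞` on sets that are not contained in `S`. -/
noncomputable def restrict (μ : ValuatedMatroid E r) (S : Finset E) :
    ValuatedMatroid E (μ.rk S) where
  toFun B := if B ⊆ S then μ.toFun (B ∪ μ.completion S) else ⊤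
  top_of_card_ne B hB := by
    split_ifs with h
    · obtain ⟨h₁, h₂⟩ := (μ.exists_base_rk S).choose_spec
      refine μ.top_of_card_ne _ fun hc => hB ?_
      have hr : (μ.exists_base_rk S).choose.card = r :=
        by_contra fun hne => h₁ (μ.top_of_card_ne _ hne)
      have hd : Disjoint B (μ.completion S) :=
        Finset.disjoint_of_subset_left h Finset.disjoint_sdiff
      rw [Finset.card_union_of_disjoint hd] at hc
      have := Finset.card_inter_add_card_sdiff (μ.exists_base_rk S).choose S
      rw [completion] at hc
      omega
    · rfl
  exists_base := by
    obtain ⟨h₁, h₂⟩ := (μ.exists_base_rk S).choose_spec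
    refine ⟨(μ.exists_base_rk S).choose ∩ S, ?_⟩
    rw [if_pos Finset.inter_subset_right, completion, Finset.union_comm, Finset.sdiff_union_inter]
    exact h₁
  exchange I J hI hJ i hi := by
    have hne : (J \ I).Nonempty := by
      rw [← Finset.card_pos, Finset.card_sdiff_comm (hJ.trans hI.symm)]
      exact Finset.card_pos.2 ⟨i, hi⟩
    by_cases hIS : I ⊆ S
    swap
    · obtain ⟨j, hj⟩ := hne
      exact ⟨j, hj, by simp [hIS]⟩
    by_cases hJS : J ⊆ S
    swap
    · obtain ⟨j, hj⟩ := hne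
      exact ⟨j, hj, by simp [hJS]⟩
    by_cases hIc : (I ∪ μ.completion S).card = r
    swap
    · obtain ⟨j, hj⟩ := hne
      exact ⟨j, hj, by simp [hIS, μ.top_of_card_ne _ hIc]⟩
    by_cases hJc : (J ∪ μ.completion S).card = r
    swap
    · obtain ⟨j, hj⟩ := hne
      exact ⟨j, hj, by simp [hJS, μ.top_of_card_ne _ hJc]⟩
    have hX : ∀ x ∈ μ.completion S, x ∉ S := fun x hx => (Finset.mem_sdiff.1 hx).2
    rw [Finset.mem_sdiff] at hi
    have hiS := hIS hi.1
    obtain ⟨j, hj, h⟩ := μ.exchange _ _ hIc hJc i (by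
      simp only [Finset.mem_sdiff, Finset.mem_union]
      exact ⟨Or.inl hi.1, fun h' => h'.elim hi.2 fun h'' => hX i h'' hiS⟩)
    simp only [Finset.mem_sdiff, Finset.mem_union, not_or] at hj
    have hjJ : j ∈ J := hj.1.resolve_right hj.2.2
    have hjS := hJS hjJ
    refine ⟨j, Finset.mem_sdiff.2 ⟨hjJ, hj.2.1⟩, ?_⟩
    have s₁ : insert j (I.erase i) ⊆ S :=
      Finset.insert_subset hjS ((Finset.erase_subset _ _).trans hIS)
    have s₂ : insert i (J.erase j) ⊆ S :=
      Finset.insert_subset hiS ((Finset.erase_subset _ _).trans hJS)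
    have e₁ : insert j ((I ∪ μ.completion S).erase i)
        = insert j (I.erase i) ∪ μ.completion S := by
      rw [Finset.erase_union_distrib, Finset.erase_eq_of_notMem (fun h' => hX i h' hiS),
        Finset.insert_union]
    have e₂ : insert i ((J ∪ μ.completion S).erase j)
        = insert i (J.erase j) ∪ μ.completion S := by
      rw [Finset.erase_union_distrib, Finset.erase_eq_of_notMem hj.2.2, Finset.insert_union]
    rw [if_pos s₁, if_pos s₂, if_pos hIS, if_pos hJS, ← e₁, ← e₂]
    exact h

end Restriction

end ValuatedMatroid

/-! ### Affine morphisms of valuated matroids -/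

/-- A map `f = (f₁, f₂) : E ∪ {o} → (E ∪ {o}) × 𝕋` (with `o = none`) that preserves `o` and has a
finite scaling factor `f₂ i` wherever `f₁ i ≠ o`. -/
structure PointedAffineMap (E : Type*) where
  fst : Option E → Option E
  snd : Option E → WithTop ℝ
  fst_none : fst none = none
  snd_ne_top : ∀ i, fst i ≠ none → snd i ≠ ⊤

namespace ValuatedMatroid

variable {E : Type*} [DecidableEq E] [Fintype E] {r s : ℕ}

/-- The restriction of `ν_o` to the image of `f₁`. -/
noncomputable def restrictImage (ν : ValuatedMatroid E r) (f : PointedAffineMap E) :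
    ValuatedMatroid (Option E) (ν.pointed.rk (Finset.univ.image f.fst)) :=
  ν.pointed.restrict (Finset.univ.image f.fst)

theorem restrictImage_of_mem (ν : ValuatedMatroid E r) (f : PointedAffineMap E)
    {B : Finset (Option E)} (h : none ∈ B) : (ν.restrictImage f).toFun B = ⊤ := by
  simp [restrictImage, restrict, pointed, h]

/-- The affine induced valuated matroid
`f⁻¹(ν)(B) = ν|_{f₁(E ∪ {o})}(f₁(B)) + ∑_{i ∈ B} f₂(i)` on `E ∪ {o}`. -/
noncomputable def affineInduced (ν : ValuatedMatroid E r) (f : PointedAffineMap E) :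
    ValuatedMatroid (Option E) (ν.pointed.rk (Finset.univ.image f.fst)) where
  toFun B := if B.card = ν.pointed.rk (Finset.univ.image f.fst) then
    (ν.restrictImage f).toFun (B.image f.fst) + ∑ i ∈ B, f.snd i else ⊤
  top_of_card_ne B hB := if_neg hB
  exists_base := by
    obtain ⟨B₀, hB₀⟩ := (ν.restrictImage f).exists_base
    have hsub : B₀ ⊆ Finset.univ.image f.fst := by
      by_contra h
      exact hB₀ (by simp [restrictImage, restrict, h])
    have hcard : B₀.card = ν.pointed.rk (Finset.univ.image f.fst) :=
      by_contra fun h => hB₀ ((ν.restrictImage f).top_of_card_ne _ h)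
    have hex : ∀ x, ∃ y, x ∈ B₀ → f.fst y = x := fun x => by
      by_cases hx : x ∈ B₀
      · obtain ⟨y, -, hy⟩ := Finset.mem_image.1 (hsub hx)
        exact ⟨y, fun _ => hy⟩
      · exact ⟨none, fun h => absurd h hx⟩
    choose g hg using hex
    have hinj : Set.InjOn g B₀ := fun x hx y hy h => by
      rw [← hg x hx, ← hg y hy, h]
    have himg : (B₀.image g).image f.fst = B₀ := by
      rw [Finset.image_image]
      conv_rhs => rw [← Finset.image_id (s := B₀)]
      exact Finset.image_congr fun x hx => hg x hx
    refine ⟨B₀.image g, ?_⟩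
    rw [if_pos (by rw [Finset.card_image_of_injOn hinj, hcard]), himg]
    refine WithTop.add_ne_top.2 ⟨hB₀, WithTop.sum_ne_top.2 fun i hi => f.snd_ne_top i ?_⟩
    intro h0
    refine hB₀ (ν.restrictImage_of_mem f ?_)
    rw [← himg, ← h0]
    exact Finset.mem_image_of_mem _ hi
  exchange I J hI hJ i hi := by
    have hne : (J \ I).Nonempty := by
      rw [← Finset.card_pos, Finset.card_sdiff_comm (hJ.trans hI.symm)]
      exact Finset.card_pos.2 ⟨i, hi⟩
    by_cases hIc : (I.image f.fst).card = ν.pointed.rk (Finset.univ.image f.fst)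
    swap
    · obtain ⟨j, hj⟩ := hne
      exact ⟨j, hj, by simp [hI, (ν.restrictImage f).top_of_card_ne _ hIc]⟩
    by_cases hJc : (J.image f.fst).card = ν.pointed.rk (Finset.univ.image f.fst)
    swap
    · obtain ⟨j, hj⟩ := hne
      exact ⟨j, hj, by simp [hJ, (ν.restrictImage f).top_of_card_ne _ hJc]⟩
    have injI : Set.InjOn f.fst I := Finset.card_image_iff.1 (hIc.trans hI.symm)
    have injJ : Set.InjOn f.fst J := Finset.card_image_iff.1 (hJc.trans hJ.symm)
    rw [Finset.mem_sdiff] at hi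
    -- it suffices to find `j` that works for the images
    suffices h : ∃ j ∈ J \ I,
        (ν.restrictImage f).toFun (insert (f.fst j) ((I.image f.fst).erase (f.fst i))) +
          (ν.restrictImage f).toFun (insert (f.fst i) ((J.image f.fst).erase (f.fst j))) ≤
        (ν.restrictImage f).toFun (I.image f.fst) +
          (ν.restrictImage f).toFun (J.image f.fst) by
      obtain ⟨j, hj, h⟩ := h
      refine ⟨j, hj, ?_⟩
      rw [Finset.mem_sdiff] at hj
      have hjI : j ∉ I.erase i := fun h' => hj.2 (Finset.mem_of_mem_erase h')
      have hiJ : i ∉ J.erase j := fun h' => hi.2 (Finset.mem_of_mem_erase h')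
      have c₁ : (insert j (I.erase i)).card = I.card := by
        rw [Finset.card_insert_of_notMem hjI, Finset.card_erase_add_one hi.1]
      have c₂ : (insert i (J.erase j)).card = J.card := by
        rw [Finset.card_insert_of_notMem hiJ, Finset.card_erase_add_one hj.1]
      have im : ∀ (L : Finset (Option E)) (x : Option E), Set.InjOn f.fst L → x ∈ L →
          (L.erase x).image f.fst = (L.image f.fst).erase (f.fst x) := by
        intro L x hL hx
        ext y
        simp only [Finset.mem_image, Finset.mem_erase]
        constructor
        · rintro ⟨z, ⟨hzx, hz⟩, rfl⟩
          exact ⟨fun h' => hzx (hL hz hx h'), z, hz, rfl⟩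
        · rintro ⟨hyx, z, hz, rfl⟩
          exact ⟨z, ⟨fun h' => hyx (h' ▸ rfl), hz⟩, rfl⟩
      rw [if_pos (c₁.trans hI), if_pos (c₂.trans hJ), if_pos hI, if_pos hJ,
        Finset.image_insert, Finset.image_insert, im I i injI hi.1, im J j injJ hj.1,
        Finset.sum_insert hjI, Finset.sum_insert hiJ, ← Finset.add_sum_erase I f.snd hi.1,
        ← Finset.add_sum_erase J f.snd hj.1]
      calc _ = ((ν.restrictImage f).toFun
                (insert (f.fst j) ((I.image f.fst).erase (f.fst i))) +
              (ν.restrictImage f).toFun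
                (insert (f.fst i) ((J.image f.fst).erase (f.fst j)))) +
              ((f.snd i + ∑ x ∈ I.erase i, f.snd x) + (f.snd j + ∑ x ∈ J.erase j, f.snd x)) := by
            ac_rfl
        _ ≤ ((ν.restrictImage f).toFun (I.image f.fst) +
              (ν.restrictImage f).toFun (J.image f.fst)) +
              ((f.snd i + ∑ x ∈ I.erase i, f.snd x) + (f.snd j + ∑ x ∈ J.erase j, f.snd x)) := by
            gcongr
        _ = _ := by ac_rfl
    have hfi : f.fst i ∈ I.image f.fst := Finset.mem_image_of_mem _ hi.1
    by_cases hiJ : f.fst i ∈ J.image f.fst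
    · obtain ⟨j, hj, hji⟩ := Finset.mem_image.1 hiJ
      refine ⟨j, Finset.mem_sdiff.2 ⟨hj, fun hjI => ?_⟩, ?_⟩
      · exact hi.2 (injI hjI hi.1 hji ▸ hj)
      · rw [hji, Finset.insert_erase hfi, Finset.insert_erase hiJ]
    · obtain ⟨y, hy, h⟩ := (ν.restrictImage f).exchange _ _ hIc hJc (f.fst i)
        (Finset.mem_sdiff.2 ⟨hfi, hiJ⟩)
      rw [Finset.mem_sdiff] at hy
      obtain ⟨j, hj, rfl⟩ := Finset.mem_image.1 hy.1
      exact ⟨j, Finset.mem_sdiff.2 ⟨hj, fun hjI => hy.2 (Finset.mem_image_of_mem _ hjI)⟩, h⟩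

/-- The affine induced valuated matroid, restricted from `E ∪ {o}` to `E`. -/
noncomputable def affinePreimage (ν : ValuatedMatroid E r) (f : PointedAffineMap E) :
    ValuatedMatroid E (ν.pointed.rk (Finset.univ.image f.fst)) :=
  (ν.affineInduced f).unpoint fun B hB => by
    have h : none ∈ B.image f.fst := Finset.mem_image.2 ⟨none, hB, f.fst_none⟩
    simp [affineInduced, ν.restrictImage_of_mem f h]

end ValuatedMatroid

/-- `f : μ → ν` is an affine morphism of valuated matroids: `f⁻¹(ν) ↞ μ`. -/
def PointedAffineMap.IsAffineMorphism {E : Type*} [DecidableEq E] [Fintype E] {r s : ℕ}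
    (f : PointedAffineMap E) (μ : ValuatedMatroid E r) (ν : ValuatedMatroid E s) : Prop :=
  (ν.affinePreimage f).IsQuotient μ

/-! ### Weakly monomial matrices, realizability -/

/-- A matrix with at most one nonzero entry in each row. -/
def Matrix.IsWeaklyMonomial {m n K : Type*} [Zero K] (A : Matrix m n K) : Prop :=
  ∀ i j j', A i j ≠ 0 → A i j' ≠ 0 → j = j'

section Field

variable {K : Type*} [Field K] (v : AddValuation K (WithTop ℝ))

open scoped Classical in
/-- The map associated to a (weakly monomial) matrix: `i ↦ (j, val(A_{ij}))` if `A_{ij} ≠ 0`, and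
`i ↦ (o, ∞)` if the row `i` is zero or `i = o`. -/
noncomputable def associatedMap {E : Type*} (A : Matrix E E K) : PointedAffineMap E where
  fst i := i.elim none fun i => if h : ∃ j, A i j ≠ 0 then some h.choose else none
  snd i := i.elim ⊤ fun i => if h : ∃ j, A i j ≠ 0 then v (A i h.choose) else ⊤
  fst_none := rfl
  snd_ne_top i hi := by
    cases i with
    | none => exact absurd rfl hi
    | some i =>
      by_cases h : ∃ j, A i j ≠ 0
      · simpa [h] using h.choose_spec
      · simp [h] at hi

/-- The tropicalization in `ℙ(𝕋^E)` of a linear subspace `L` of `K^E`: the points at which the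
tropicalization of every linear form that vanishes on `L` attains its minimum at least twice. -/
def tropSubspace {E : Type*} [Fintype E] (L : Submodule K (E → K)) : Set (TropProj E) :=
  {p | ∃ x : TropVec E, p = x.mk ∧
    ∀ a : E → K, (∀ y ∈ L, ∑ i, a i * y i = 0) → MinTwice fun i => v (a i) + x.1 i}

/-- The subspace `L` of `K^n` realizes the valuated matroid `μ`: it is the row span of a matrix `A`
with linearly independent rows such that, up to equivalence, `μ(B)` is the valuation of the
maximal minor of `A` on the columns `B`. -/
def Realizes {n r : ℕ} (L : Submodule K (Fin n → K)) (μ : ValuatedMatroid (Fin n) r) : Prop :=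
  ∃ A : Matrix (Fin r) (Fin n) K, LinearIndependent K (fun k => A k) ∧
    Submodule.span K (Set.range fun k => A k) = L ∧
    ∃ c : ℝ, ∀ (B : Finset (Fin n)) (hB : B.card = r),
      μ.toFun B = v (A.submatrix id (B.orderEmbOfFin hB)).det + (c : WithTop ℝ)

/-- The valuated matroid `μ` is realizable over `K`. -/
def IsRealizable {n r : ℕ} (μ : ValuatedMatroid (Fin n) r) : Prop :=
  ∃ L : Submodule K (Fin n → K), Realizes v L μ

/-- The pair `μ`, `ν` is a realizable quotient `μ ↞ ν`: it arises from a containment of linear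
subspaces. -/
def IsRealizableQuotient {n r s : ℕ} (μ : ValuatedMatroid (Fin n) r)
    (ν : ValuatedMatroid (Fin n) s) : Prop :=
  μ.IsQuotient ν ∧ ∃ L₁ L₂ : Submodule K (Fin n → K), L₁ ≤ L₂ ∧ Realizes v L₁ μ ∧ Realizes v L₂ ν

/-- `f : μ → ν` is a realizable affine morphism of valuated matroids: `μ` and `ν` are realizable,
`f` is an affine morphism, and both `f⁻¹(ν)` and the quotient `f⁻¹(ν) ↞ μ` are realizable. -/
def IsRealizableAffineMorphism {n r s : ℕ} (f : PointedAffineMap (Fin n))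
    (μ : ValuatedMatroid (Fin n) r) (ν : ValuatedMatroid (Fin n) s) : Prop :=
  IsRealizable v μ ∧ IsRealizable v ν ∧ f.IsAffineMorphism μ ν ∧
    IsRealizable v (ν.affinePreimage f) ∧ IsRealizableQuotient v (ν.affinePreimage f) μ

/-- The containment `val(M) ⊙ trop(μ) ⊆ trop(ν)`. -/
def TropContainment {n r s : ℕ} (M : Matrix (Fin n) (Fin n) K) (μ : ValuatedMatroid (Fin n) r)
    (ν : ValuatedMatroid (Fin n) s) : Prop :=
  tropImage (M.map v) μ.trop ⊆ ν.trop

/-- The containment `val(M) ⊙ trop(μ) ⊆ trop(ν)` is realizable: `trop(μ)` is the tropicalization of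
a linear subspace, and the containment is the tropicalization of a containment of linear
subspaces. -/
def IsRealizableContainment {n r s : ℕ} (M : Matrix (Fin n) (Fin n) K)
    (μ : ValuatedMatroid (Fin n) r) (ν : ValuatedMatroid (Fin n) s) : Prop :=
  (∃ U : Submodule K (Fin n → K), tropSubspace v U = μ.trop) ∧
    ∃ L₁ L₂ : Submodule K (Fin n → K), L₁ ≤ L₂ ∧
      tropSubspace v L₁ = tropImage (M.map v) μ.trop ∧ tropSubspace v L₂ = ν.trop

/-! ### Quiver Dressians -/

/-- The tropicalization `⨁_u val(a_u) ⊙ x^u` of the polynomial `F = ∑_u a_u x^u` attains its minimum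
at the tropical vector `x` at least twice. -/
def TropVanishes {σ : Type*} (F : MvPolynomial σ K) (x : σ → WithTop ℝ) : Prop :=
  MinTwice fun u : F.support => v (F.coeff u.1) + u.1.sum fun i k => k • x i

/-- The Plücker variable `p_B`, in the polynomial ring whose variables are the `r`-subsets of
`[n]` (and `0` for a set of another cardinality, which the relations below do not involve). -/
noncomputable def pluckerVar (K : Type*) [Field K] {n : ℕ} (r : ℕ) (B : Finset (Fin n)) :
    MvPolynomial {B : Finset (Fin n) // B.card = r} K :=
  if h : B.card = r then MvPolynomial.X ⟨B, h⟩ else 0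

/-- The sign `(-1)^(#{j' ∈ J : i < j'} + #{i' ∈ I : j < i'})` of the term in which `j` is added to `I`
and `i` is removed from `J`. -/
def pluckerSign {n : ℕ} (i j : Fin n) (I J : Finset (Fin n)) : ℤ :=
  (-1) ^ ((J.filter fun j' => i < j').card + (I.filter fun i' => j < i').card)

/-- The Grassmann-Plücker relations
`∑_{j ∈ J \ I} ± p_{I ∪ j} p_{J \ j}`, `|I| = r - 1`, `|J| = r + 1`. -/
noncomputable def grassmannPlucker (K : Type*) [Field K] (n r : ℕ) :
    Set (MvPolynomial {B : Finset (Fin n) // B.card = r} K) :=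
  {F | ∃ I J : Finset (Fin n), I.card + 1 = r ∧ J.card = r + 1 ∧
    F = ∑ j ∈ J \ I, MvPolynomial.C ((pluckerSign j j I J : ℤ) : K) *
      pluckerVar K r (insert j I) * pluckerVar K r (J.erase j)}

/-- The quiver Plücker relations of an arrow with matrix `M`,
`∑_{j ∉ I, i ∈ J} ± M_{ij} p_{I ∪ j} q_{J \ i}`, `|I| = r - 1`, `|J| = s + 1`, in the variables `p`
of the source and `q` of the target of the arrow. -/
noncomputable def quiverPlucker {n : ℕ} (M : Matrix (Fin n) (Fin n) K) (r s : ℕ) :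
    Set (MvPolynomial
      ({B : Finset (Fin n) // B.card = r} ⊕ {B : Finset (Fin n) // B.card = s}) K) :=
  {F | ∃ I J : Finset (Fin n), I.card + 1 = r ∧ J.card = s + 1 ∧
    F = ∑ j ∈ Iᶜ, ∑ i ∈ J, MvPolynomial.C (((pluckerSign i j I J : ℤ) : K) * M i j) *
      MvPolynomial.rename Sum.inl (pluckerVar K r (insert j I)) *
      MvPolynomial.rename Sum.inr (pluckerVar K s (J.erase i))}

/-- The quiver Dressian `QDr(M, d; n)` of the representation of a quiver with vertex set `V` that
assigns `K^n` to each vertex and the matrix `M α` to each arrow `α`: the tropical prevariety in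
`∏_i ℙ(𝕋^{binom(n, d_i)})` cut out by the tropical Grassmann-Plücker relations of the vertices and
the tropical quiver Plücker relations of the arrows. -/
def quiverDressian {V : Type*} [Quiver V] {n : ℕ}
    (M : ∀ ⦃i j : V⦄, (i ⟶ j) → Matrix (Fin n) (Fin n) K) (d : V → ℕ) :
    Set (∀ i, TropProj {B : Finset (Fin n) // B.card = d i}) :=
  {p | ∃ x : ∀ i, TropVec {B : Finset (Fin n) // B.card = d i}, (∀ i, p i = (x i).mk) ∧
    (∀ i, ∀ F ∈ grassmannPlucker K n (d i), TropVanishes v F (x i).1) ∧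
    ∀ ⦃i j : V⦄ (α : i ⟶ j), ∀ F ∈ quiverPlucker (M α) (d i) (d j),
      TropVanishes v F (Sum.elim (x i).1 (x j).1)}

end Field

/-! ### Tropical linear combinations -/

/-! Everything reduces to tropical orthogonality of circuits and cocircuits. The space trop(μ) is
cut out by circuits, but it is also the tropical span of the vectors j ↦ μ(A ∪ j)
(`ValuatedMatroid.trop_eq_tropSpan`). Tropical matrices carry spans to spans (`tropImage_tropSpan`),
and a tropical hyperplane contains a span as soon as it contains the generators. So an inclusion P ⊙
trop(μ) ⊆ trop(ν) is a condition on pairs: a cocircuit of μ and a circuit of ν.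

Without a matrix, these conditions are the exchange inequalities of a quotient
(`ValuatedMatroid.trop_subset_trop_iff`). If M is weakly monomial, each minimum in val(M) ⊙ x has at
most one finite term, and the cocircuits and circuits of f⁻¹(μ) can be compared directly with those
of μ: val(M) ⊙ trop(μ) = trop(f⁻¹(μ)) (`Matrix.IsWeaklyMonomial.trop_affinePreimage`). Together
these give the equivalence of containments and affine morphisms. Read in Plücker coordinates, the
condition on a pair is a tropical quiver Plücker relation
(`Matrix.IsWeaklyMonomial.tropVanishes_iff`); as the Grassmann-Plücker relations hold tropically at
every valuated matroid, this describes the quiver Dressian.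

For realizability, the maximal minors of a matrix with row span L provide vectors of L and linear
forms vanishing on L whose valuations are the cocircuits and circuits. Hence trop(L) = trop(μ) if L
realizes μ, and conversely because trop(μ) determines μ up to a constant (`realizes_iff`). Both
notions of realizability then ask for the same subspaces. Finally, no cancellation occurs in M·y, so
trop(M·U) = val(M) ⊙ trop(U). -/

/-- This form does not mention the minimum, so it can be checked one finite term at a time and
survives passing to larger or translated families. -/
theorem minTwice_iff {ι : Type*} [Finite ι] {a : ι → WithTop ℝ} :
    MinTwice a ↔ ∀ i, a i ≠ ⊤ → ∃ j, j ≠ i ∧ a j ≤ a i := by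
  constructor
  · rintro (h | ⟨p, q, hpq, he, hle⟩) i hi
    · exact absurd (h i) hi
    · by_cases hp : p = i
      · exact ⟨q, fun h => hpq (hp.trans h.symm), he ▸ hle i⟩
      · exact ⟨p, hp, hle i⟩
  · intro h
    by_cases htop : ∀ i, a i = ⊤
    · exact Or.inl htop
    · push Not at htop
      obtain ⟨i₀, hi₀⟩ := htop
      have : Nonempty ι := ⟨i₀⟩
      obtain ⟨i, hi⟩ := Finite.exists_min a
      obtain ⟨j, hj, hle⟩ := h i fun h => hi₀ (top_le_iff.1 (h ▸ hi i₀))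
      exact Or.inr ⟨i, j, hj.symm, le_antisymm (hi j) hle, hi⟩

theorem MinTwice.add_const {ι : Type*} [Finite ι] {a : ι → WithTop ℝ} (h : MinTwice a)
    (c : WithTop ℝ) : MinTwice fun i => a i + c := by
  rw [minTwice_iff] at h ⊢
  intro i hi
  obtain ⟨j, hj, hle⟩ := h i (WithTop.add_ne_top.1 hi).1
  exact ⟨j, hj, by gcongr⟩

/-- `x` is a tropical linear combination of vectors in `S`. -/
def IsTropComb {ι : Type*} (S : Set (ι → WithTop ℝ)) (x : ι → WithTop ℝ) : Prop :=
  ∀ i, x i ≠ ⊤ → ∃ w ∈ S, ∃ c : ℝ, (∀ j, x j ≤ w j + c) ∧ w i + c = x i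

namespace IsTropComb

variable {ι κ : Type*} {S T : Set (ι → WithTop ℝ)} {x y : ι → WithTop ℝ}

theorem of_mem (h : x ∈ S) : IsTropComb S x :=
  fun i _ => ⟨x, h, 0, fun j => by simp, by simp⟩

theorem of_eq_add {c : ℝ} (h : x ∈ S) (hy : ∀ i, y i = x i + c) : IsTropComb S y :=
  fun i _ => ⟨x, h, c, fun j => (hy j).le, (hy i).symm⟩

theorem trans (h : IsTropComb S x) (hST : ∀ w ∈ S, IsTropComb T w) : IsTropComb T x := by
  intro i hi
  obtain ⟨w, hw, c, hle, he⟩ := h i hi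
  have hwi : w i ≠ ⊤ := fun h' => hi (by rw [← he, h', top_add])
  obtain ⟨u, hu, d, hle', he'⟩ := hST w hw i hwi
  refine ⟨u, hu, d + c, fun j => ?_, ?_⟩
  · rw [WithTop.coe_add, ← add_assoc]
    exact (hle j).trans (by gcongr; exact hle' j)
  · rw [WithTop.coe_add, ← add_assoc, he', he]

/-- For a finite term i, use the generator that touches x at i. It lies above x elsewhere, so its
second small term bounds a second term for x. -/
theorem minTwice [Finite ι] {C : ι → WithTop ℝ} (h : IsTropComb S x)
    (hS : ∀ w ∈ S, MinTwice fun i => C i + w i) : MinTwice fun i => C i + x i := by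
  rw [minTwice_iff]
  intro i hi
  rw [WithTop.add_ne_top] at hi
  obtain ⟨w, hw, c, hle, he⟩ := h i hi.2
  have hwi : w i ≠ ⊤ := fun h' => hi.2 (by rw [← he, h', top_add])
  obtain ⟨j, hj, hji⟩ := minTwice_iff.1 (hS w hw) i (WithTop.add_ne_top.2 ⟨hi.1, hwi⟩)
  refine ⟨j, hj, ?_⟩
  calc C j + x j ≤ C j + (w j + c) := by gcongr; exact hle j
    _ = (C j + w j) + c := (add_assoc _ _ _).symm
    _ ≤ (C i + w i) + c := by gcongr
    _ = C i + x i := by rw [add_assoc, he]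

end IsTropComb

/-! ### Tropical matrices and tropical spans -/

section tropMulVec

variable {m n : Type*} [Fintype n] (P : Matrix m n (WithTop ℝ))

theorem tropMulVec_le (x : n → WithTop ℝ) (i : m) (j : n) : tropMulVec P x i ≤ P i j + x j :=
  Finset.inf_le (Finset.mem_univ j)

theorem exists_tropMulVec_eq {x : n → WithTop ℝ} {i : m} (h : tropMulVec P x i ≠ ⊤) :
    ∃ j, tropMulVec P x i = P i j + x j := by
  have hne : (Finset.univ : Finset n).Nonempty := by
    rw [Finset.nonempty_iff_ne_empty]
    intro he
    exact h (by rw [tropMulVec, he, Finset.inf_empty])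
  obtain ⟨j, -, hj⟩ := Finset.exists_mem_eq_inf Finset.univ hne fun j => P i j + x j
  exact ⟨j, hj⟩

theorem le_tropMulVec {x : n → WithTop ℝ} {i : m} {a : WithTop ℝ} (h : ∀ j, a ≤ P i j + x j) :
    a ≤ tropMulVec P x i :=
  Finset.le_inf fun j _ => h j

theorem tropMulVec_le_add {x w : n → WithTop ℝ} {c : ℝ} (h : ∀ j, x j ≤ w j + c) (i : m) :
    tropMulVec P x i ≤ tropMulVec P w i + c := by
  by_cases ht : tropMulVec P w i = ⊤
  · simp [ht]
  · obtain ⟨j, hj⟩ := exists_tropMulVec_eq P ht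
    rw [hj, add_assoc]
    exact (tropMulVec_le P x i j).trans (by gcongr; exact h j)

theorem IsTropComb.tropMulVec {S : Set (n → WithTop ℝ)} {x : n → WithTop ℝ}
    (h : IsTropComb S x) : IsTropComb (tropMulVec P '' S) (tropMulVec P x) := by
  intro i hi
  obtain ⟨j, hj⟩ := exists_tropMulVec_eq P hi
  have hj' := hi
  rw [hj, WithTop.add_ne_top] at hj'
  obtain ⟨w, hw, c, hle, he⟩ := h j hj'.2
  refine ⟨_, ⟨w, hw, rfl⟩, c, tropMulVec_le_add P hle, le_antisymm ?_ (tropMulVec_le_add P hle i)⟩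
  rw [hj, ← he, ← add_assoc]
  gcongr
  exact tropMulVec_le P w i j

/-- One translated generator is chosen for each finite coordinate of y; the preimage x is the
pointwise minimum of these finitely many translates. -/
theorem IsTropComb.exists_tropMulVec_eq [Finite m] {S : Set (n → WithTop ℝ)} {y : m → WithTop ℝ}
    (h : IsTropComb (_root_.tropMulVec P '' S) y) :
    ∃ x, IsTropComb S x ∧ y = _root_.tropMulVec P x := by
  classical
  cases nonempty_fintype m
  have h' : ∀ i : {i // y i ≠ ⊤}, ∃ w ∈ S, ∃ c : ℝ,
      (∀ j, y j ≤ _root_.tropMulVec P w j + c) ∧ _root_.tropMulVec P w i + c = y i := by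
    rintro ⟨i, hi⟩
    obtain ⟨_, ⟨w, hw, rfl⟩, c, hc⟩ := h i hi
    exact ⟨w, hw, c, hc⟩
  choose w hw c hle he using h'
  let x : n → WithTop ℝ := fun j => Finset.univ.inf fun i => w i j + c i
  have hx : ∀ i j, x j ≤ w i j + c i := fun i j => Finset.inf_le (Finset.mem_univ i)
  have hx' : ∀ j, x j ≠ ⊤ → ∃ i, x j = w i j + c i := by
    intro j hj
    have hne : (Finset.univ : Finset {i // y i ≠ ⊤}).Nonempty := by
      rw [Finset.nonempty_iff_ne_empty]
      intro he
      exact hj (by simp only [x]; rw [he, Finset.inf_empty])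
    obtain ⟨i, -, hi⟩ := Finset.exists_mem_eq_inf Finset.univ hne fun i => w i j + c i
    exact ⟨i, hi⟩
  refine ⟨x, fun j hj => ?_, funext fun i => le_antisymm ?_ ?_⟩
  · obtain ⟨i, hi⟩ := hx' j hj
    exact ⟨w i, hw i, c i, hx i, hi.symm⟩
  · refine le_tropMulVec P fun j => ?_
    by_cases hj : x j = ⊤
    · simp [hj]
    · obtain ⟨k, hk⟩ := hx' j hj
      rw [hk, ← add_assoc]
      refine (hle k i).trans ?_
      gcongr
      exact tropMulVec_le P (w k) i j
  · by_cases hi : y i = ⊤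
    · simp [hi]
    · rw [← he ⟨i, hi⟩]
      exact tropMulVec_le_add P (hx ⟨i, hi⟩) i

end tropMulVec

/-- The points of tropical projective space that are tropical linear combinations of vectors in
`S`. -/
def tropSpan {ι : Type*} (S : Set (ι → WithTop ℝ)) : Set (TropProj ι) :=
  {p | ∃ x : TropVec ι, p = x.mk ∧ IsTropComb S x.1}

theorem TropVec.mk_eq_iff {ι : Type*} {x y : TropVec ι} :
    x.mk = y.mk ↔ ∃ c : ℝ, ∀ i, x.1 i = y.1 i + c :=
  ⟨fun h => Quotient.exact h, fun h => Quotient.sound h⟩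

theorem mk_mem_tropSpan {ι : Type*} {S : Set (ι → WithTop ℝ)} {x : TropVec ι} :
    x.mk ∈ tropSpan S ↔ IsTropComb S x.1 := by
  refine ⟨?_, fun h => ⟨x, rfl, h⟩⟩
  rintro ⟨y, hxy, hy⟩
  obtain ⟨c, hc⟩ := TropVec.mk_eq_iff.1 hxy
  exact (IsTropComb.of_eq_add (Set.mem_singleton y.1) hc).trans fun w hw => by
    rwa [Set.mem_singleton_iff.1 hw]

theorem tropSpan_subset {ι : Type*} {S T : Set (ι → WithTop ℝ)}
    (h : ∀ w ∈ S, IsTropComb T w) : tropSpan S ⊆ tropSpan T := by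
  rintro _ ⟨x, rfl, hx⟩
  exact ⟨x, rfl, hx.trans h⟩

theorem tropImage_tropSpan {m n : Type*} [Finite m] [Fintype n] (P : Matrix m n (WithTop ℝ))
    (S : Set (n → WithTop ℝ)) : tropImage P (tropSpan S) = tropSpan (tropMulVec P '' S) := by
  ext q
  constructor
  · rintro ⟨x, y, hx, hy, rfl⟩
    refine ⟨y, rfl, ?_⟩
    rw [hy]
    exact (mk_mem_tropSpan.1 hx).tropMulVec P
  · rintro ⟨y, rfl, hy⟩
    obtain ⟨x, hx, hyx⟩ := hy.exists_tropMulVec_eq P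
    obtain ⟨i, hi⟩ := y.2
    rw [hyx] at hi
    obtain ⟨j, hj⟩ := exists_tropMulVec_eq P hi
    rw [hj, WithTop.add_ne_top] at hi
    exact ⟨⟨x, j, hi.2⟩, y, mk_mem_tropSpan.2 hx, hyx, rfl⟩

/-! ### Tropical linear spaces -/

namespace ValuatedMatroid

variable {E : Type*} [DecidableEq E] {r s : ℕ}

theorem card_eq (μ : ValuatedMatroid E r) {B : Finset E} (h : μ.toFun B ≠ ⊤) : B.card = r :=
  by_contra fun h' => h (μ.top_of_card_ne B h')

/-- The vector with coordinates `μ(A ∪ j)`, a multiple of a valuated cocircuit of `μ` (or constantly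
`∞`). -/
def cocircuitVec (μ : ValuatedMatroid E r) (A : Finset E) : E → WithTop ℝ :=
  fun j => if j ∈ A then ⊤ else μ.toFun (insert j A)

theorem mk_mem_trop [Finite E] {μ : ValuatedMatroid E r} {x : TropVec E} :
    x.mk ∈ μ.trop ↔
      ∀ I : Finset E, I.card = r + 1 → MinTwice fun i => μ.circuitVec I i + x.1 i := by
  constructor
  · rintro ⟨y, hxy, hy⟩ I hI
    obtain ⟨c, hc⟩ := TropVec.mk_eq_iff.1 hxy
    by_cases h : ∃ i, μ.circuitVec I i ≠ ⊤
    · simpa only [hc, add_assoc] using (hy _ ⟨I, hI, rfl, h⟩).add_const c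
    · push Not at h
      exact Or.inl fun i => by simp only [h i, top_add]
  · intro h
    refine ⟨x, rfl, ?_⟩
    rintro _ ⟨I, hI, rfl, -⟩
    exact h I hI

/-- Consider the bases that minimize μ(B) - ∑_{b ∈ B} x_b. Orthogonality of x to the circuits puts
every i with x_i finite into such a basis B, and optimality of B under exchanging i for j says that
the cocircuit of B \ i, translated to agree with x at i, lies above x. Infinite x_b weigh -∞, so the
minimization is lexicographic: first the number `N` of elements with finite coordinate, then the
finite part `W`. -/
theorem isTropComb_cocircuitVec [Fintype E] (μ : ValuatedMatroid E r) {x : E → WithTop ℝ}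
    (hx : ∀ I : Finset E, I.card = r + 1 → MinTwice fun i => μ.circuitVec I i + x i) :
    IsTropComb (Set.range μ.cocircuitVec) x := by
  classical
  -- the weight of a basis, in lexicographic order
  let N : Finset E → ℕ := fun B => (B.filter fun b => x b ≠ ⊤).card
  let W : Finset E → ℝ := fun B =>
    (μ.toFun B).untopD 0 - ∑ b ∈ B.filter (fun b => x b ≠ ⊤), (x b).untopD 0
  have hN : ∀ i j B, i ∉ B → j ∈ insert i B → N ((insert i B).erase j) + (if x j ≠ ⊤ then 1 else 0)
      = N B + (if x i ≠ ⊤ then 1 else 0) := by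
    intro i j B hi hj
    have h1 : N (insert i B) = N B + (if x i ≠ ⊤ then 1 else 0) := by
      simp only [N, Finset.filter_insert]
      split_ifs <;> simp [hi]
    have h2 : N ((insert i B).erase j) + (if x j ≠ ⊤ then 1 else 0) = N (insert i B) := by
      simp only [N, Finset.filter_erase]
      split_ifs with h
      · exact Finset.card_erase_add_one (by simp [h, hj])
      · rw [Finset.erase_eq_of_notMem (by simpa using fun _ => by simpa using h), add_zero]
    rw [h2, h1]
  have hW : ∀ i j B, i ∉ B → j ∈ insert i B → x i ≠ ⊤ → x j ≠ ⊤ →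
      W ((insert i B).erase j) = W B + (μ.toFun ((insert i B).erase j)).untopD 0
        - (μ.toFun B).untopD 0 + (x j).untopD 0 - (x i).untopD 0 := by
    intro i j B hi hj hxi hxj
    have h := Finset.sum_erase_add ((insert i B).filter fun b => x b ≠ ⊤)
      (fun b => (x b).untopD 0) (a := j) (by simp [hxj, hj])
    rw [← Finset.filter_erase, Finset.filter_insert, if_pos hxi,
      Finset.sum_insert (by simp [hi])] at h
    simp only [W]
    linarith
  obtain ⟨B₀, hB₀⟩ := μ.exists_base
  let bases : Finset (Finset E) := Finset.univ.filter fun B => μ.toFun B ≠ ⊤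
  obtain ⟨B₁, hB₁, hmin₁⟩ := Finset.exists_min_image bases N ⟨B₀, by simpa [bases] using hB₀⟩
  obtain ⟨B₂, hB₂, hmin₂⟩ := Finset.exists_min_image (bases.filter fun B => N B = N B₁) W
    ⟨B₁, by simpa using hB₁⟩
  let Opt : Finset E → Prop := fun B => μ.toFun B ≠ ⊤ ∧
    (∀ B', μ.toFun B' ≠ ⊤ → N B ≤ N B') ∧ ∀ B', μ.toFun B' ≠ ⊤ → N B' = N B → W B ≤ W B'
  have hopt : Opt B₂ := by
    simp only [bases, Finset.mem_filter, Finset.mem_univ, true_and] at hB₁ hB₂ hmin₁ hmin₂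
    exact ⟨hB₂.1, fun B' h => hB₂.2.le.trans (hmin₁ B' h),
      fun B' h h' => hmin₂ B' ⟨h, h'.trans hB₂.2⟩⟩
  -- every element with finite coordinate is contained in an optimal basis
  have key : ∀ i, x i ≠ ⊤ → ∃ B, i ∈ B ∧ Opt B := by
    intro i hi
    by_cases hiB : i ∈ B₂
    · exact ⟨B₂, hiB, hopt⟩
    have hcard : (insert i B₂).card = r + 1 := by
      rw [Finset.card_insert_of_notMem hiB, μ.card_eq hopt.1]
    have hci : μ.circuitVec (insert i B₂) i = μ.toFun B₂ := by
      simp [circuitVec, Finset.erase_insert hiB]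
    -- The circuit in B₂ ∪ i has a second term j no larger than the one at i. Exchanging j for i
    -- keeps `N` and does not increase `W`.
    obtain ⟨j, hji, hle⟩ := minTwice_iff.1 (hx _ hcard) i (by
      rw [hci]; exact WithTop.add_ne_top.2 ⟨hopt.1, hi⟩)
    rw [hci] at hle
    have hfin : μ.circuitVec (insert i B₂) j + x j ≠ ⊤ :=
      ne_top_of_le_ne_top (WithTop.add_ne_top.2 ⟨hopt.1, hi⟩) hle
    rw [WithTop.add_ne_top] at hfin
    have hjI : j ∈ insert i B₂ := by
      by_contra h
      exact hfin.1 (by simp [circuitVec, h])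
    have hcj : μ.circuitVec (insert i B₂) j = μ.toFun ((insert i B₂).erase j) := by
      rw [circuitVec, if_pos hjI]
    rw [hcj] at hle hfin
    have hNj := hN i j B₂ hiB hjI
    rw [if_pos hi, if_pos hfin.2, add_left_inj] at hNj
    have hWj := hW i j B₂ hiB hjI hi hfin.2
    have hle' : (μ.toFun ((insert i B₂).erase j)).untopD 0 + (x j).untopD 0 ≤
        (μ.toFun B₂).untopD 0 + (x i).untopD 0 := by
      lift μ.toFun ((insert i B₂).erase j) to ℝ using hfin.1 with a
      lift μ.toFun B₂ to ℝ using hopt.1 with b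
      lift x j to ℝ using hfin.2 with c
      lift x i to ℝ using hi with d
      simpa using (by exact_mod_cast hle : a + c ≤ b + d)
    refine ⟨(insert i B₂).erase j, Finset.mem_erase.2 ⟨hji.symm, Finset.mem_insert_self _ _⟩,
      hfin.1, fun B' h => hNj ▸ hopt.2.1 B' h, fun B' h h' => ?_⟩
    have := hopt.2.2 B' h (h'.trans hNj)
    linarith
  intro i hi
  obtain ⟨B, hiB, hB, hBN, hBW⟩ := key i hi
  have hii : insert i (B.erase i) = B := Finset.insert_erase hiB
  refine ⟨_, ⟨B.erase i, rfl⟩, (x i).untopD 0 - (μ.toFun B).untopD 0, fun j => ?_, ?_⟩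
  · by_cases hjB : j ∈ B.erase i
    · simp [cocircuitVec, hjB]
    rw [cocircuitVec, if_neg hjB]
    by_cases hfin : μ.toFun (insert j (B.erase i)) = ⊤
    · simp [hfin]
    by_cases hji : j = i
    · subst hji
      rw [hii]
      lift μ.toFun B to ℝ using hB with b
      lift x j to ℝ using hi with d
      norm_cast
      simp
    have hjB' : j ∉ B := fun h => hjB (Finset.mem_erase.2 ⟨hji, h⟩)
    have hset : (insert j B).erase i = insert j (B.erase i) :=
      Finset.erase_insert_of_ne hji
    have hmem : i ∈ insert j B := Finset.mem_insert_of_mem hiB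
    have hNj := hN j i B hjB' hmem
    rw [hset, if_pos hi] at hNj
    -- Exchanging i for an element with infinite coordinate would lower `N`.
    have hxj : x j ≠ ⊤ := by
      intro h
      rw [if_neg (not_not.2 h)] at hNj
      have := hBN _ hfin
      omega
    rw [if_pos hxj, add_left_inj] at hNj
    have hWj := hW j i B hjB' hmem hxj hi
    rw [hset] at hWj
    have := hBW _ hfin hNj
    lift μ.toFun (insert j (B.erase i)) to ℝ using hfin with a
    lift μ.toFun B to ℝ using hB with b
    lift x j to ℝ using hxj with c
    lift x i to ℝ using hi with d
    simp only [WithTop.untopD_coe] at *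
    norm_cast
    linarith
  · rw [cocircuitVec, if_neg (Finset.notMem_erase _ _), hii]
    lift μ.toFun B to ℝ using hB with b
    lift x i to ℝ using hi with d
    norm_cast
    simp

end ValuatedMatroid

/-! ### Orthogonality of circuits and cocircuits, quotients -/

namespace ValuatedMatroid

variable {E : Type*} [DecidableEq E] {r s : ℕ}

/-- The exchange relation between `g` and `h` in the form of tropical Plücker relations. -/
theorem exchange_iff_minTwice [Finite E] {g h : Finset E → WithTop ℝ}
    (hg : ∀ B, B.card ≠ r → g B = ⊤) (hrs : r ≤ s) :
    (∀ I J : Finset E, I.card = r → J.card = s → ∀ i ∈ I \ J, ∃ j ∈ J \ I,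
      g (insert j (I.erase i)) + h (insert i (J.erase j)) ≤ g I + h J) ↔
    ∀ A I : Finset E, I.card = s + 1 → MinTwice fun j =>
      (if j ∈ I then h (I.erase j) else ⊤) + (if j ∈ A then ⊤ else g (insert j A)) := by
  simp only [minTwice_iff]
  constructor
  · intro H A I hI i hi
    rw [WithTop.add_ne_top] at hi
    have hiI : i ∈ I := by by_contra h; simp [h] at hi
    have hiA : i ∉ A := by intro h; simp [h] at hi
    rw [if_pos hiI, if_neg hiA] at hi ⊢
    -- The two forms correspond by trading the sets (I, J) of an exchange at i for (I \ i, J ∪ i),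
    -- and back.
    have hc : (insert i A).card = r := by_contra fun h => hi.2 (hg _ h)
    obtain ⟨j, hj, hle⟩ := H (insert i A) (I.erase i) hc
      (by rw [Finset.card_erase_of_mem hiI, hI, Nat.add_sub_cancel]) i (by simp)
    simp only [Finset.mem_sdiff, Finset.mem_erase, Finset.mem_insert, not_or] at hj
    refine ⟨j, hj.1.1, ?_⟩
    rw [if_pos hj.1.2, if_neg hj.2.2]
    rw [Finset.erase_insert hiA, Finset.erase_right_comm,
      Finset.insert_erase (Finset.mem_erase.2 ⟨hj.1.1.symm, hiI⟩)] at hle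
    rwa [add_comm, add_comm (h (I.erase i))]
  · intro H I J hI hJ i hi
    rw [Finset.mem_sdiff] at hi
    -- An element j must be exhibited even when the right-hand side is ∞; r ≤ s guarantees one.
    have hne : (J \ I).Nonempty := by
      have h1 := Finset.card_sdiff_add_card_inter I J
      have h2 := Finset.card_sdiff_add_card_inter J I
      have h3 : 0 < (I \ J).card := Finset.card_pos.2 ⟨i, Finset.mem_sdiff.2 hi⟩
      rw [Finset.inter_comm] at h2
      exact Finset.card_pos.1 (by omega)
    by_cases hfin : g I + h J = ⊤
    · obtain ⟨j, hj⟩ := hne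
      exact ⟨j, hj, by simp [hfin]⟩
    have hval : (if i ∈ insert i J then h ((insert i J).erase i) else ⊤) +
        (if i ∈ I.erase i then ⊤ else g (insert i (I.erase i))) = g I + h J := by
      rw [if_pos (Finset.mem_insert_self _ _), if_neg (Finset.notMem_erase _ _),
        Finset.erase_insert hi.2, Finset.insert_erase hi.1, add_comm]
    obtain ⟨j, hji, hle⟩ := H (I.erase i) (insert i J)
      (by rw [Finset.card_insert_of_notMem hi.2, hJ]) i (by rw [hval]; exact hfin)
    rw [hval] at hle
    have hfin' := ne_top_of_le_ne_top hfin hle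
    rw [WithTop.add_ne_top] at hfin'
    have hjJ : j ∈ insert i J := by by_contra h; simp [h] at hfin'
    have hjI : j ∉ I.erase i := by intro h; simp [h] at hfin'
    rw [if_pos hjJ, if_neg hjI, Finset.erase_insert_of_ne hji.symm, add_comm] at hle
    exact ⟨j, Finset.mem_sdiff.2 ⟨Finset.mem_of_mem_insert_of_ne hjJ hji,
      fun h => hjI (Finset.mem_erase.2 ⟨hji, h⟩)⟩, hle⟩

/-- This is the exchange axiom of μ itself, with μ in both roles. -/
theorem minTwice_circuitVec_add_cocircuitVec [Finite E] (μ : ValuatedMatroid E r) (A : Finset E)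
    {I : Finset E} (hI : I.card = r + 1) :
    MinTwice fun i => μ.circuitVec I i + μ.cocircuitVec A i :=
  (exchange_iff_minTwice μ.top_of_card_ne le_rfl).1 μ.exchange A I hI

/-- The tropical linear space of `μ` is spanned by the valuated cocircuits. -/
theorem trop_eq_tropSpan [Fintype E] (μ : ValuatedMatroid E r) :
    μ.trop = tropSpan (Set.range μ.cocircuitVec) := by
  ext p
  constructor
  · rintro ⟨x, rfl, hx⟩
    exact mk_mem_tropSpan.2 (μ.isTropComb_cocircuitVec (mk_mem_trop.1 ⟨x, rfl, hx⟩))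
  · rintro ⟨x, rfl, hx⟩
    refine mk_mem_trop.2 fun I hI => hx.minTwice ?_
    rintro _ ⟨A, rfl⟩
    exact μ.minTwice_circuitVec_add_cocircuitVec A hI

/-- Generators that are constantly ∞ define no projective point, but satisfy every circuit condition
trivially. -/
theorem tropSpan_subset_trop_iff [Fintype E] {S : Set (E → WithTop ℝ)}
    {μ : ValuatedMatroid E r} : tropSpan S ⊆ μ.trop ↔
      ∀ w ∈ S, ∀ I : Finset E, I.card = r + 1 → MinTwice fun i => μ.circuitVec I i + w i := by
  constructor
  · intro h w hw I hI
    by_cases hfin : ∃ i, w i ≠ ⊤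
    · exact mk_mem_trop.1 (h ((mk_mem_tropSpan (x := ⟨w, hfin⟩)).2 (IsTropComb.of_mem hw))) I hI
    · push Not at hfin
      exact Or.inl fun i => by simp only [hfin i, add_top]
  · rintro h _ ⟨x, rfl, hx⟩
    exact mk_mem_trop.2 fun I hI => hx.minTwice fun w hw => h w hw I hI

/-- A basis J of ν with |I \ J| minimal contains I, since an exchange would shrink I \ J. Only
supports are involved and r ≤ s is not assumed, so the lemma can be used to prove that inequality.
-/
theorem exists_subset_of_exchange [Finite E] {μ : ValuatedMatroid E r} {ν : ValuatedMatroid E s}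
    (h : ∀ I J : Finset E, I.card = r → J.card = s → ∀ i ∈ I \ J, μ.toFun I ≠ ⊤ → ν.toFun J ≠ ⊤ →
      ∃ j, ν.toFun (insert i (J.erase j)) ≠ ⊤ ∧ j ∈ J \ I) {I : Finset E} (hI : μ.toFun I ≠ ⊤) :
    ∃ J, ν.toFun J ≠ ⊤ ∧ I ⊆ J := by
  classical
  cases nonempty_fintype E
  obtain ⟨J₀, hJ₀⟩ := ν.exists_base
  obtain ⟨J, hJ, hmin⟩ := Finset.exists_min_image
    (Finset.univ.filter fun J => ν.toFun J ≠ ⊤) (fun J => (I \ J).card) ⟨J₀, by simpa using hJ₀⟩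
  simp only [Finset.mem_filter, Finset.mem_univ, true_and] at hJ hmin
  refine ⟨J, hJ, fun i hi => ?_⟩
  by_contra hiJ
  have hiIJ : i ∈ I \ J := Finset.mem_sdiff.2 ⟨hi, hiJ⟩
  obtain ⟨j, hj, hjJI⟩ := h I J (μ.card_eq hI) (ν.card_eq hJ) i hiIJ hI hJ
  rw [Finset.mem_sdiff] at hjJI
  have hlt : (I \ insert i (J.erase j)).card < (I \ J).card := by
    refine Finset.card_lt_card ⟨fun a ha => ?_, fun hsub => ?_⟩
    · simp only [Finset.mem_sdiff, Finset.mem_insert, Finset.mem_erase, not_or, not_and] at ha ⊢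
      exact ⟨ha.1, fun haJ => ha.2.2 (fun haj => hjJI.2 (haj ▸ ha.1)) haJ⟩
    · have := hsub hiIJ
      simp at this
  exact absurd (hmin _ hj) (not_le.2 hlt)

/-- Valuated matroid quotients are containments of tropical linear spaces. -/
theorem trop_subset_trop_iff [Fintype E] {μ : ValuatedMatroid E r} {ν : ValuatedMatroid E s} :
    μ.trop ⊆ ν.trop ↔ μ.IsQuotient ν := by
  rw [trop_eq_tropSpan μ, tropSpan_subset_trop_iff, Set.forall_mem_range]
  constructor
  · intro h
    -- The rank inequality is needed before `exchange_iff_minTwice` applies; it follows once a basis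
    -- of μ is contained in a basis of ν.
    have hrs : r ≤ s := by
      obtain ⟨I, hI⟩ := μ.exists_base
      obtain ⟨J, hJ, hIJ⟩ := exists_subset_of_exchange (μ := μ) (ν := ν) (fun I J hI hJ i hi hμ hν => by
        rw [Finset.mem_sdiff] at hi
        have hval : ν.circuitVec (insert i J) i + μ.cocircuitVec (I.erase i) i
            = ν.toFun J + μ.toFun I := by
          rw [circuitVec, cocircuitVec, if_pos (Finset.mem_insert_self _ _),
            if_neg (Finset.notMem_erase _ _), Finset.erase_insert hi.2, Finset.insert_erase hi.1]
        have hfin : ν.toFun J + μ.toFun I ≠ ⊤ := WithTop.add_ne_top.2 ⟨hν, hμ⟩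
        obtain ⟨j, hji, hle⟩ := minTwice_iff.1 (h (I.erase i) (insert i J)
          (by rw [Finset.card_insert_of_notMem hi.2, hJ])) i (by rw [hval]; exact hfin)
        rw [hval] at hle
        have hfin' := ne_top_of_le_ne_top hfin hle
        rw [WithTop.add_ne_top, circuitVec, cocircuitVec] at hfin'
        have hjJ : j ∈ insert i J := by by_contra h; simp [h] at hfin'
        have hjI : j ∉ I.erase i := by intro h; simp [h] at hfin'
        rw [if_pos hjJ, Finset.erase_insert_of_ne hji.symm] at hfin'
        exact ⟨j, hfin'.1, Finset.mem_sdiff.2 ⟨Finset.mem_of_mem_insert_of_ne hjJ hji,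
          fun h => hjI (Finset.mem_erase.2 ⟨hji, h⟩)⟩⟩) hI
      rw [← μ.card_eq hI, ← ν.card_eq hJ]
      exact Finset.card_le_card hIJ
    exact ⟨hrs, (exchange_iff_minTwice μ.top_of_card_ne hrs).2 h⟩
  · rintro ⟨hrs, h⟩
    exact (exchange_iff_minTwice μ.top_of_card_ne hrs).1 h

theorem IsQuotient.base_of_base [Finite E] {μ ν : ValuatedMatroid E r} (h : μ.IsQuotient ν)
    {I : Finset E} (hI : μ.toFun I ≠ ⊤) : ν.toFun I ≠ ⊤ := by
  obtain ⟨J, hJ, hIJ⟩ := exists_subset_of_exchange (μ := μ) (ν := ν) (fun I J hI hJ i hi hμ hν => by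
    obtain ⟨j, hj, hle⟩ := h.2 I J hI hJ i hi
    exact ⟨j, (WithTop.add_ne_top.1 (ne_top_of_le_ne_top (WithTop.add_ne_top.2 ⟨hμ, hν⟩) hle)).2,
      hj⟩) hI
  rwa [Finset.eq_of_subset_of_card_le hIJ (by rw [μ.card_eq hI, ν.card_eq hJ])]

/-- Valuated matroids that are quotients of each other are equivalent. -/
theorem eq_add_of_isQuotient [Finite E] {μ ν : ValuatedMatroid E r} (h : μ.IsQuotient ν)
    (h' : ν.IsQuotient μ) : ∃ c : ℝ, ∀ B, μ.toFun B = ν.toFun B + c := by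
  obtain ⟨B₀, hB₀⟩ := μ.exists_base
  -- the difference is constant along basis exchanges
  have key : ∀ k : ℕ, ∀ I J, (I \ J).card = k → μ.toFun I ≠ ⊤ → μ.toFun J ≠ ⊤ →
      μ.toFun J + ν.toFun I = μ.toFun I + ν.toFun J := by
    intro k
    induction k with
    | zero =>
      intro I J hIJ hI hJ
      rw [Finset.card_eq_zero, Finset.sdiff_eq_empty_iff_subset] at hIJ
      rw [Finset.eq_of_subset_of_card_le hIJ (by rw [μ.card_eq hI, μ.card_eq hJ])]
    | succ k ih =>
      intro I J hIJ hI hJ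
      obtain ⟨i, hi⟩ := Finset.card_pos.1 (by omega : 0 < (I \ J).card)
      obtain ⟨j, hj, hle⟩ := μ.exchange I J (μ.card_eq hI) (μ.card_eq hJ) i hi
      rw [Finset.mem_sdiff] at hi hj
      have hI' : μ.toFun (insert j (I.erase i)) ≠ ⊤ :=
        (WithTop.add_ne_top.1 (ne_top_of_le_ne_top (WithTop.add_ne_top.2 ⟨hI, hJ⟩) hle)).1
      set I' := insert j (I.erase i) with hI'def
      have hij : i ≠ j := fun h => hj.2 (h ▸ hi.1)
      have hII' : I \ I' = {i} := by
        ext a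
        simp only [hI'def, Finset.mem_sdiff, Finset.mem_insert, Finset.mem_erase, not_or,
          not_and, Finset.mem_singleton]
        constructor
        · rintro ⟨ha, haj, h⟩
          by_contra hai
          exact h hai ha
        · rintro rfl
          exact ⟨hi.1, hij, fun h => absurd rfl h⟩
      have hI'I : I' \ I = {j} := by
        ext a
        simp only [hI'def, Finset.mem_sdiff, Finset.mem_insert, Finset.mem_erase,
          Finset.mem_singleton]
        constructor
        · rintro ⟨haj | ha, haI⟩
          · exact haj
          · exact absurd ha.2 haI
        · rintro rfl
          exact ⟨Or.inl rfl, hj.2⟩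
      have e : insert i (I'.erase j) = I := by
        rw [hI'def, Finset.erase_insert fun h => hj.2 (Finset.mem_of_mem_erase h),
          Finset.insert_erase hi.1]
      -- For adjacent bases only one exchange is possible, so the two quotient conditions give
      -- opposite inequalities.
      have adj : μ.toFun I' + ν.toFun I = μ.toFun I + ν.toFun I' := by
        refine le_antisymm ?_ ?_
        · obtain ⟨j', hj', hle'⟩ := h.2 I I' (μ.card_eq hI) (μ.card_eq hI') i (by simp [hII'])
          rw [hI'I, Finset.mem_singleton] at hj'
          subst hj'
          rwa [e] at hle'
        · obtain ⟨j', hj', hle'⟩ := h'.2 I I' (μ.card_eq hI) (μ.card_eq hI') i (by simp [hII'])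
          rw [hI'I, Finset.mem_singleton] at hj'
          subst hj'
          rw [e] at hle'
          rwa [add_comm (μ.toFun I), add_comm (μ.toFun I')]
      have hcard : (I' \ J).card = k := by
        have : I' \ J = (I \ J).erase i := by
          ext a
          simp only [hI'def, Finset.mem_sdiff, Finset.mem_insert, Finset.mem_erase]
          constructor
          · rintro ⟨rfl | ha, haJ⟩
            · exact absurd hj.1 haJ
            · exact ⟨ha.1, ha.2, haJ⟩
          · rintro ⟨ha, haI, haJ⟩
            exact ⟨Or.inr ⟨ha, haI⟩, haJ⟩
        rw [this, Finset.card_erase_of_mem (Finset.mem_sdiff.2 hi), hIJ, Nat.add_sub_cancel]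
      have ih' := ih I' J hcard hI' hJ
      have hνI := h.base_of_base hI
      have hνI' := h.base_of_base hI'
      have hνJ := h.base_of_base hJ
      lift μ.toFun I' to ℝ using hI' with a₁
      lift ν.toFun I' to ℝ using hνI' with a₂
      lift μ.toFun I to ℝ using hI with b₁
      lift ν.toFun I to ℝ using hνI with b₂
      lift μ.toFun J to ℝ using hJ with c₁
      lift ν.toFun J to ℝ using hνJ with c₂
      norm_cast at *
      linarith
  refine ⟨(μ.toFun B₀).untopD 0 - (ν.toFun B₀).untopD 0, fun B => ?_⟩
  by_cases hB : μ.toFun B = ⊤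
  · have : ν.toFun B = ⊤ := by_contra fun hB' => h'.base_of_base hB' hB
    rw [hB, this, top_add]
  · have hk := key _ B₀ B rfl hB₀ hB
    have hν := h.base_of_base hB
    have hν₀ := h.base_of_base hB₀
    lift μ.toFun B to ℝ using hB with a₁
    lift ν.toFun B to ℝ using hν with a₂
    lift μ.toFun B₀ to ℝ using hB₀ with b₁
    lift ν.toFun B₀ to ℝ using hν₀ with b₂
    simp only [WithTop.untopD_coe]
    norm_cast at *
    linarith

theorem rank_eq_of_trop_eq [Fintype E] {μ : ValuatedMatroid E r} {ν : ValuatedMatroid E s}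
    (h : μ.trop = ν.trop) : r = s :=
  le_antisymm (trop_subset_trop_iff.1 h.subset).1 (trop_subset_trop_iff.1 h.symm.subset).1

theorem eq_add_of_trop_eq [Fintype E] {μ ν : ValuatedMatroid E r} (h : μ.trop = ν.trop) :
    ∃ c : ℝ, ∀ B, μ.toFun B = ν.toFun B + c :=
  eq_add_of_isQuotient (trop_subset_trop_iff.1 h.subset) (trop_subset_trop_iff.1 h.symm.subset)

end ValuatedMatroid

/-! ### Maximal minors: circuits and cocircuits of a row space -/

section Minors

variable {K : Type*} [Field K] (v : AddValuation K (WithTop ℝ)) {n r : ℕ}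

theorem AddValuation.map_int_units (u : ℤˣ) : v ((u : ℤ) : K) = 0 := by
  rcases Int.units_eq_one_or u with rfl | rfl <;> simp [v.map_neg]

/-- If a finite sum vanishes, the minimum of the valuations of its terms is attained twice. -/
theorem AddValuation.minTwice_of_sum_eq_zero {ι : Type*} [Fintype ι] {a : ι → K}
    (h : ∑ i, a i = 0) : MinTwice fun i => v (a i) := by
  classical
  refine minTwice_iff.2 fun i hi => ?_
  by_contra! hlt
  have hsum := Finset.add_sum_erase Finset.univ a (Finset.mem_univ i)
  rw [h] at hsum
  have : v (a i) < v (∑ j ∈ Finset.univ.erase i, a j) :=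
    v.map_lt_sum hi fun j hj => hlt j (Finset.ne_of_mem_erase hj)
  rw [eq_neg_of_add_eq_zero_left hsum, v.map_neg] at this
  exact lt_irrefl _ this

/-- The valuation of the maximal minor of `A` on the columns `B`, and `∞` if `B` does not have the
right cardinality. -/
noncomputable def minorVal (A : Matrix (Fin r) (Fin n) K) (B : Finset (Fin n)) : WithTop ℝ :=
  if h : B.card = r then v (A.submatrix id (B.orderEmbOfFin h)).det else ⊤

theorem minorVal_of_card_ne (A : Matrix (Fin r) (Fin n) K) {B : Finset (Fin n)}
    (h : B.card ≠ r) : minorVal v A B = ⊤ :=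
  dif_neg h

/-- Reordering columns changes the determinant by a sign, which has valuation 0. -/
theorem map_det_submatrix (A : Matrix (Fin r) (Fin n) K) {g : Fin r → Fin n}
    (hg : Function.Injective g) :
    v (A.submatrix id g).det = minorVal v A (Finset.univ.image g) := by
  have hB : (Finset.univ.image g).card = r := by
    rw [Finset.card_image_of_injective _ hg, Finset.card_univ, Fintype.card_fin]
  rw [minorVal, dif_pos hB]
  let σ : Fin r → Fin r := fun k => ((Finset.univ.image g).orderIsoOfFin hB).symm
    ⟨g k, Finset.mem_image_of_mem g (Finset.mem_univ k)⟩
  have hσ : ∀ k, (Finset.univ.image g).orderEmbOfFin hB (σ k) = g k := fun k => by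
    rw [← Finset.coe_orderIsoOfFin_apply, OrderIso.apply_symm_apply]
  have hinj : Function.Injective σ := fun a b hab => hg (by rw [← hσ a, hab, hσ b])
  let τ : Equiv.Perm (Fin r) := Equiv.ofBijective σ (Finite.injective_iff_bijective.1 hinj)
  have : A.submatrix id g = (A.submatrix id ((Finset.univ.image g).orderEmbOfFin hB)).submatrix
      id τ := by
    ext a b
    simp only [Matrix.submatrix_apply, id]
    rw [← hσ b]
    rfl
  rw [this, Matrix.det_permute', v.map_mul, AddValuation.map_int_units, zero_add]

/-- Lifts a cocircuit to the row space. The vector has j-th coordinate det(A_j | A_S); expansion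
along the first column writes it as a combination of the rows. -/
theorem exists_mem_span_map_eq (A : Matrix (Fin r) (Fin n) K) (S : Finset (Fin n)) :
    ∃ w ∈ Submodule.span K (Set.range fun k => A k), ∀ j,
      v (w j) = if j ∈ S then ⊤ else minorVal v A (insert j S) := by
  by_cases hS : S.card + 1 = r
  swap
  · refine ⟨0, Submodule.zero_mem _, fun j => ?_⟩
    split_ifs with hj
    · simp
    · rw [minorVal_of_card_ne, Pi.zero_apply, v.map_zero]
      rwa [Finset.card_insert_of_notMem hj]
  subst hS
  let e : Fin S.card → Fin n := S.orderEmbOfFin rfl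
  have he : Finset.univ.image e = S := Finset.image_orderEmbOfFin_univ S rfl
  refine ⟨fun j => (A.submatrix id (Fin.cons j e : Fin (S.card + 1) → Fin n)).det, ?_, fun j => ?_⟩
  · have : (fun j => (A.submatrix id (Fin.cons j e : Fin (S.card + 1) → Fin n)).det)
        = ∑ k : Fin (S.card + 1), ((-1) ^ (k : ℕ) * (A.submatrix k.succAbove e).det) • A k := by
      ext j
      rw [Matrix.det_succ_column_zero, Finset.sum_apply]
      refine Finset.sum_congr rfl fun k _ => ?_
      rw [Matrix.submatrix_submatrix]
      simp only [Matrix.submatrix_apply, id, Fin.cons_zero, Pi.smul_apply, smul_eq_mul]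
      have : (Fin.cons j e : Fin (S.card + 1) → Fin n) ∘ Fin.succ = e := by
        ext; simp
      rw [this, Function.id_comp]
      ring
    rw [this]
    exact Submodule.sum_mem _ fun k _ => Submodule.smul_mem _ _ (Submodule.subset_span ⟨k, rfl⟩)
  · split_ifs with hj
    · obtain ⟨k, -, rfl⟩ := Finset.mem_image.1 (he.symm ▸ hj)
      have : (A.submatrix id (Fin.cons (e k) e : Fin (S.card + 1) → Fin n)).det = 0 :=
        Matrix.det_zero_of_column_eq (Fin.succ_ne_zero k) (fun l => by simp)
      dsimp only
      rw [this, v.map_zero]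
    · rw [map_det_submatrix]
      · congr 1
        ext a
        have ha : a ∈ S ↔ ∃ k, e k = a := by
          conv_lhs => rw [← he]
          simp
        simp [Fin.exists_fin_succ, ha, eq_comm]
      · exact Fin.cons_injective_iff.2 ⟨by
          rintro ⟨k, rfl⟩
          exact hj (he ▸ Finset.mem_image_of_mem e (Finset.mem_univ k)),
          (S.orderEmbOfFin rfl).injective⟩

/-- Lifts a circuit to a linear form, with signed minors on I \ i as coefficients. Its value at a
row of A is the expansion of a determinant in which that row occurs twice. -/
theorem exists_form_map_eq (A : Matrix (Fin r) (Fin n) K) {I : Finset (Fin n)}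
    (hI : I.card = r + 1) :
    ∃ a : Fin n → K, (∀ y ∈ Submodule.span K (Set.range fun k => A k), ∑ i, a i * y i = 0) ∧
      ∀ i, v (a i) = if i ∈ I then minorVal v A (I.erase i) else ⊤ := by
  let g := I.orderEmbOfFin hI
  have hg : Finset.univ.image g = I := Finset.image_orderEmbOfFin_univ I hI
  let b : Fin (r + 1) → K := fun k => (-1) ^ (k : ℕ) * (A.submatrix id (g ∘ k.succAbove)).det
  let a : Fin n → K := Function.extend g b 0
  have ha : ∀ k, a (g k) = b k := fun k => g.injective.extend_apply b (0 : Fin n → K) k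
  have ha' : ∀ i, i ∉ I → a i = 0 := fun i hi => Function.extend_apply' b (0 : Fin n → K) i (by
    rintro ⟨k, rfl⟩
    exact hi (hg ▸ Finset.mem_image_of_mem g (Finset.mem_univ k)))
  refine ⟨a, fun y hy => ?_, fun i => ?_⟩
  · induction hy using Submodule.span_induction with
    | mem y hy =>
      obtain ⟨l, rfl⟩ := hy
      have h1 : ∑ i, a i * A l i = ∑ i ∈ I, a i * A l i :=
        (Finset.sum_subset (Finset.subset_univ I) fun i _ hi => by rw [ha' i hi, zero_mul]).symm
      dsimp only
      rw [h1, ← hg, Finset.sum_image g.injective.injOn]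
      have h2 := Matrix.det_succ_row_zero
        (Matrix.of (Fin.cons (A l ∘ g) fun k => A k ∘ g) : Matrix (Fin (r + 1)) (Fin (r + 1)) K)
      rw [Matrix.det_zero_of_row_eq (Fin.succ_ne_zero l).symm (by ext; simp)] at h2
      rw [h2]
      refine Finset.sum_congr rfl fun k _ => ?_
      rw [ha]
      have : (Matrix.of (Fin.cons (A l ∘ g) fun k => A k ∘ g) :
          Matrix (Fin (r + 1)) (Fin (r + 1)) K).submatrix Fin.succ k.succAbove
          = A.submatrix id (g ∘ k.succAbove) := by
        ext; simp
      rw [this]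
      simp only [b, Matrix.of_apply, Fin.cons_zero, Function.comp_apply]
      ring
    | zero => simp
    | add y z _ _ hy hz => simp [mul_add, Finset.sum_add_distrib, hy, hz]
    | smul c y _ hy =>
      simp only [Pi.smul_apply, smul_eq_mul, mul_left_comm _ c, ← Finset.mul_sum, hy, mul_zero]
  · split_ifs with hi
    · obtain ⟨k, -, rfl⟩ := Finset.mem_image.1 (hg.symm ▸ hi)
      have hsign : v ((-1 : K) ^ (k : ℕ)) = 0 := by simp [v.map_pow, v.map_neg]
      rw [ha, v.map_mul, hsign, zero_add,
        map_det_submatrix v A (g.injective.comp Fin.succAbove_right_injective)]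
      congr 1
      have hmem : ∀ i, i ∈ I ↔ ∃ k, g k = i := fun i => by
        conv_lhs => rw [← hg]
        simp
      ext i
      simp only [Finset.mem_image, Finset.mem_univ, true_and, Finset.mem_erase, hmem]
      constructor
      · rintro ⟨m, rfl⟩
        exact ⟨fun h => Fin.succAbove_ne k m (g.injective h), _, rfl⟩
      · rintro ⟨hne, m, rfl⟩
        obtain ⟨m', rfl⟩ := Fin.exists_succAbove_eq fun h : m = k => hne (by rw [h])
        exact ⟨m', rfl⟩
    · rw [ha' i hi, v.map_zero]

/-- Row rank equals column rank, so r linearly independent columns exist. -/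
theorem exists_minorVal_ne_top {A : Matrix (Fin r) (Fin n) K}
    (hA : LinearIndependent K fun k => A k) : ∃ B, minorVal v A B ≠ ⊤ := by
  have hrank : A.rank = r := by
    have := LinearIndependent.rank_matrix (M := A) hA
    simpa using this
  obtain ⟨κ, c, hc, hspan, hli⟩ := exists_linearIndependent' K A.col
  have := Finite.of_injective c hc
  cases nonempty_fintype κ
  have hcard : Fintype.card κ = r := by
    rw [← hrank, Matrix.rank_eq_finrank_span_cols, ← hspan, finrank_span_eq_card hli]
  let e : Fin r ≃ κ := (Fintype.equivFinOfCardEq hcard).symm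
  have hdet : (A.submatrix id (c ∘ e)).det ≠ 0 := by
    rw [← isUnit_iff_ne_zero, ← Matrix.isUnit_iff_isUnit_det,
      ← Matrix.linearIndependent_cols_iff_isUnit]
    exact hli.comp e e.injective
  refine ⟨Finset.univ.image (c ∘ e), ?_⟩
  rw [← map_det_submatrix v A (hc.comp e.injective)]
  exact fun h => hdet (v.top_iff.1 h)

/-- The valuated matroid of the row span of a matrix with linearly independent rows. -/
noncomputable def minorMatroid {A : Matrix (Fin r) (Fin n) K}
    (hA : LinearIndependent K fun k => A k) : ValuatedMatroid (Fin n) r where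
  toFun := minorVal v A
  top_of_card_ne B hB := minorVal_of_card_ne v A hB
  exists_base := exists_minorVal_ne_top v hA
  exchange := by
    -- The exchange axiom is tropical orthogonality of a circuit and a cocircuit. These lift to a
    -- form `a` and a vector `w` with ∑ a_i w_i = 0.
    refine (ValuatedMatroid.exchange_iff_minTwice (fun B hB => minorVal_of_card_ne v A hB)
      le_rfl).2 fun S I hI => ?_
    obtain ⟨w, hw, hwv⟩ := exists_mem_span_map_eq v A S
    obtain ⟨a, ha, hav⟩ := exists_form_map_eq v A hI
    simpa only [v.map_mul, hwv, hav] using v.minTwice_of_sum_eq_zero (ha w hw)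

end Minors

/-! ### Tropicalized subspaces and realizability -/

section Subspaces

variable {K : Type*} [Field K] (v : AddValuation K (WithTop ℝ)) {n r : ℕ}

/-- The valuations of the elements of `L`. -/
def valVecs {E : Type*} (L : Submodule K (E → K)) : Set (E → WithTop ℝ) :=
  {w | ∃ y ∈ L, w = fun i => v (y i)}

theorem tropSpan_valVecs_subset {E : Type*} [Fintype E] (L : Submodule K (E → K)) :
    tropSpan (valVecs v L) ⊆ tropSubspace v L := by
  rintro _ ⟨x, rfl, hx⟩
  refine ⟨x, rfl, fun a ha => hx.minTwice ?_⟩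
  rintro _ ⟨y, hy, rfl⟩
  simpa only [v.map_mul] using v.minTwice_of_sum_eq_zero (ha y hy)

theorem exists_realizes (L : Submodule K (Fin n → K)) :
    ∃ (r : ℕ) (μ : ValuatedMatroid (Fin n) r), Realizes v L μ := by
  let b := Module.finBasis K L
  have hli : LinearIndependent K fun k => (b k : Fin n → K) :=
    b.linearIndependent.map' L.subtype L.ker_subtype
  refine ⟨_, minorMatroid v (A := fun k => (b k : Fin n → K)) hli, _, hli, ?_, 0, fun B hB => ?_⟩
  · have := congrArg (Submodule.map L.subtype) b.span_eq
    rwa [Submodule.map_span, ← Set.range_comp, Submodule.map_top, Submodule.range_subtype] at this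
  · simp only [minorMatroid, minorVal, dif_pos hB]
    simp

variable {v}

theorem Realizes.exists_eq_minorVal {L : Submodule K (Fin n → K)} {μ : ValuatedMatroid (Fin n) r}
    (h : Realizes v L μ) : ∃ A : Matrix (Fin r) (Fin n) K,
      Submodule.span K (Set.range fun k => A k) = L ∧
      ∃ c : ℝ, ∀ B, μ.toFun B = minorVal v A B + c := by
  obtain ⟨A, -, hL, c, hc⟩ := h
  refine ⟨A, hL, c, fun B => ?_⟩
  by_cases hB : B.card = r
  · rw [hc B hB, minorVal, dif_pos hB]
  · rw [μ.top_of_card_ne B hB, minorVal_of_card_ne v A hB, top_add]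

/-- The circuits of μ are, up to a constant, valuations of forms vanishing on L. With
`Realizes.trop_subset` and `tropSpan_valVecs_subset` this closes a cycle of inclusions. Working with
spans rather than closures of `valVecs` makes it valid for any value group, including the trivial
one. -/
theorem Realizes.tropSubspace_subset {L : Submodule K (Fin n → K)}
    {μ : ValuatedMatroid (Fin n) r} (h : Realizes v L μ) : tropSubspace v L ⊆ μ.trop := by
  obtain ⟨A, rfl, c, hc⟩ := h.exists_eq_minorVal
  rintro _ ⟨x, rfl, hx⟩
  refine ValuatedMatroid.mk_mem_trop.2 fun I hI => ?_
  obtain ⟨a, ha, hav⟩ := exists_form_map_eq v A hI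
  convert (hx a ha).add_const c using 2 with i
  rw [hav, ValuatedMatroid.circuitVec, add_right_comm]
  congr 1
  split_ifs
  · exact hc _
  · rfl

theorem Realizes.trop_subset {L : Submodule K (Fin n → K)}
    {μ : ValuatedMatroid (Fin n) r} (h : Realizes v L μ) : μ.trop ⊆ tropSpan (valVecs v L) := by
  obtain ⟨A, rfl, c, hc⟩ := h.exists_eq_minorVal
  rw [μ.trop_eq_tropSpan]
  refine tropSpan_subset (Set.forall_mem_range.2 fun S => ?_)
  obtain ⟨w, hw, hwv⟩ := exists_mem_span_map_eq v A S
  refine IsTropComb.of_eq_add (c := c) ⟨w, hw, rfl⟩ fun j => ?_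
  rw [hwv, ValuatedMatroid.cocircuitVec]
  split_ifs
  · rfl
  · exact hc _

theorem Realizes.tropSubspace_eq {L : Submodule K (Fin n → K)}
    {μ : ValuatedMatroid (Fin n) r} (h : Realizes v L μ) : tropSubspace v L = μ.trop :=
  h.tropSubspace_subset.antisymm (h.trop_subset.trans (tropSpan_valVecs_subset v L))

/-- The tropicalization of `L` is spanned by the valuations of the elements of `L`. -/
theorem tropSubspace_eq_tropSpan (L : Submodule K (Fin n → K)) :
    tropSubspace v L = tropSpan (valVecs v L) := by
  obtain ⟨r, μ, h⟩ := exists_realizes v L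
  exact (h.tropSubspace_subset.trans h.trop_subset).antisymm (tropSpan_valVecs_subset v L)

/-- L always realizes some valuated matroid, and a tropical linear space determines its rank and its
valuated matroid up to a constant. -/
theorem realizes_iff {L : Submodule K (Fin n → K)} {μ : ValuatedMatroid (Fin n) r} :
    Realizes v L μ ↔ tropSubspace v L = μ.trop := by
  refine ⟨Realizes.tropSubspace_eq, fun h => ?_⟩
  obtain ⟨r', μ', h'⟩ := exists_realizes v L
  have htrop : μ.trop = μ'.trop := by rw [← h, h'.tropSubspace_eq]
  obtain rfl := ValuatedMatroid.rank_eq_of_trop_eq htrop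
  obtain ⟨c, hc⟩ := ValuatedMatroid.eq_add_of_trop_eq htrop
  obtain ⟨A, hA, hL, d, hd⟩ := h'
  exact ⟨A, hA, hL, d + c, fun B hB => by rw [hc, hd B hB, add_assoc, WithTop.coe_add]⟩

theorem tropSubspace_mono {E : Type*} [Fintype E] {L₁ L₂ : Submodule K (E → K)} (h : L₁ ≤ L₂) :
    tropSubspace v L₁ ⊆ tropSubspace v L₂ := by
  rintro _ ⟨x, rfl, hx⟩
  exact ⟨x, rfl, fun a ha => hx a fun y hy => ha y (h hy)⟩

end Subspaces

/-! ### Weakly monomial matrices commute with valuation -/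

section WeaklyMonomial

variable {K : Type*} [Field K] (v : AddValuation K (WithTop ℝ)) {E : Type*} [Fintype E]
  {M : Matrix E E K}

theorem tropMulVec_map_eq_top {i : E} (h : ∀ j, M i j = 0) (x : E → WithTop ℝ) :
    tropMulVec (M.map v) x i = ⊤ :=
  top_le_iff.1 (le_tropMulVec _ fun j => by simp [h j])

theorem Matrix.IsWeaklyMonomial.tropMulVec_map (hM : M.IsWeaklyMonomial) {i j : E}
    (h : M i j ≠ 0) (x : E → WithTop ℝ) : tropMulVec (M.map v) x i = v (M i j) + x j := by
  refine le_antisymm (tropMulVec_le _ x i j) (le_tropMulVec _ fun j' => ?_)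
  by_cases hj : M i j' = 0
  · simp [hj]
  · rw [hM i j' j hj h, Matrix.map_apply]

/-- Each coordinate of M·y has at most one nonzero summand, so nothing can cancel. -/
theorem Matrix.IsWeaklyMonomial.map_mulVec (hM : M.IsWeaklyMonomial) (y : E → K) (i : E) :
    v (M.mulVec y i) = tropMulVec (M.map v) (fun j => v (y j)) i := by
  by_cases h : ∃ j, M i j ≠ 0
  · obtain ⟨j, hj⟩ := h
    rw [hM.tropMulVec_map v hj, ← v.map_mul]
    congr 1
    exact Finset.sum_eq_single_of_mem j (Finset.mem_univ j) fun j' _ hj' => by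
      have h0 : M i j' = 0 := by_contra fun h => hj' (hM i j' j h hj)
      simp only [h0, zero_mul]
  · push Not at h
    rw [tropMulVec_map_eq_top v h]
    simp [Matrix.mulVec, dotProduct, h]

end WeaklyMonomial

/-- Both sides are spanned by the vectors val(M·y) = val(M) ⊙ val(y), y ∈ U. -/
theorem Matrix.IsWeaklyMonomial.tropSubspace_map {K : Type*} [Field K]
    (v : AddValuation K (WithTop ℝ)) {n : ℕ} {M : Matrix (Fin n) (Fin n) K}
    (hM : M.IsWeaklyMonomial) (U : Submodule K (Fin n → K)) :
    tropSubspace v (U.map M.mulVecLin) = tropImage (M.map v) (tropSubspace v U) := by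
  rw [tropSubspace_eq_tropSpan, tropSubspace_eq_tropSpan, tropImage_tropSpan]
  congr 1
  ext w
  constructor
  · rintro ⟨_, ⟨y, hy, rfl⟩, rfl⟩
    exact ⟨_, ⟨y, hy, rfl⟩, funext fun i => (hM.map_mulVec v y i).symm⟩
  · rintro ⟨_, ⟨y, hy, rfl⟩, rfl⟩
    exact ⟨_, ⟨y, hy, rfl⟩, funext fun i => (hM.map_mulVec v y i).symm⟩

/-! ### The affine induced valuated matroid and images of tropical linear spaces -/

namespace ValuatedMatroid

variable {E : Type*} [DecidableEq E] [Fintype E] {r s : ℕ}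

theorem card_inter_le_rk (μ : ValuatedMatroid E r) (S : Finset E) {B : Finset E}
    (hB : μ.toFun B ≠ ⊤) : (B ∩ S).card ≤ μ.rk S := by
  classical
  rw [rk]
  convert Finset.le_sup (f := fun B => (B ∩ S).card)
    (s := Finset.univ.filter fun B => μ.toFun B ≠ ⊤) (b := B) (by simpa using hB)

/-- The affine induced valuated matroid in terms of a completion `X ⊆ E` of the image of `f₁`. -/
theorem exists_affinePreimage_eq (μ : ValuatedMatroid E r) (f : PointedAffineMap E) :
    ∃ X : Finset E, X.card + μ.pointed.rk (Finset.univ.image f.fst) = r ∧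
      (∀ i l, f.fst (some i) = some l → l ∉ X) ∧
      (∀ T B : Finset E, (∀ l ∈ T, ∃ i, f.fst (some i) = some l) → μ.toFun B ≠ ⊤ → T ⊆ B →
        T.card ≤ μ.pointed.rk (Finset.univ.image f.fst)) ∧
      (∀ B, (∃ i ∈ B, f.fst (some i) = none) → (μ.affinePreimage f).toFun B = ⊤) ∧
      ∀ (B : Finset E) (g : E → E), B.card = μ.pointed.rk (Finset.univ.image f.fst) →
        (∀ i ∈ B, f.fst (some i) = some (g i)) →
        (μ.affinePreimage f).toFun B = μ.toFun (B.image g ∪ X) + ∑ i ∈ B, f.snd (some i) := by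
  set S := Finset.univ.image f.fst with hS
  have hval : ∀ B : Finset E, (μ.affinePreimage f).toFun B =
      if (B.map Function.Embedding.some).card = μ.pointed.rk S then
        (if (B.map Function.Embedding.some).image f.fst ⊆ S then
          μ.pointed.toFun ((B.map Function.Embedding.some).image f.fst ∪ μ.pointed.completion S)
          else ⊤) + ∑ i ∈ B.map Function.Embedding.some, f.snd i
      else ⊤ := fun B => rfl
  obtain ⟨h₁, h₂⟩ := (μ.pointed.exists_base_rk S).choose_spec
  have hcompl : μ.pointed.completion S = (μ.pointed.exists_base_rk S).choose \ S := rfl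
  set B₀ := (μ.pointed.exists_base_rk S).choose
  -- The point o is a loop, so it lies in no basis and the completion can be regarded as a subset of
  -- E.
  have hnone : none ∉ μ.pointed.completion S := by
    rw [hcompl, Finset.mem_sdiff]
    rintro ⟨h, -⟩
    exact h₁ (by simp [pointed, h])
  have himg : ∀ B : Finset E, (B.map Function.Embedding.some).image f.fst ⊆ S := fun B =>
    Finset.image_subset_image (Finset.subset_univ _)
  refine ⟨(μ.pointed.completion S).eraseNone, ?_, ?_, ?_, ?_, ?_⟩
  · rw [Finset.card_eraseNone_of_not_mem hnone, hcompl, ← h₂, Finset.card_sdiff_add_card_inter]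
    exact μ.pointed.card_eq h₁
  · intro i l hil hl
    rw [Finset.mem_eraseNone, hcompl, Finset.mem_sdiff] at hl
    exact hl.2 (hil ▸ Finset.mem_image_of_mem _ (Finset.mem_univ _))
  · intro T B hT hB hTB
    have hB' : μ.pointed.toFun (B.map Function.Embedding.some) ≠ ⊤ := by simpa [pointed] using hB
    refine le_trans ?_ (μ.pointed.card_inter_le_rk S hB')
    rw [← Finset.card_map Function.Embedding.some]
    refine Finset.card_le_card fun a ha => ?_
    obtain ⟨l, hl, rfl⟩ := Finset.mem_map.1 ha
    obtain ⟨i, hi⟩ := hT l hl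
    exact Finset.mem_inter.2 ⟨Finset.mem_map_of_mem _ (hTB hl),
      Finset.mem_image.2 ⟨some i, Finset.mem_univ _, hi⟩⟩
  · rintro B ⟨i, hi, hio⟩
    have : none ∈ (B.map Function.Embedding.some).image f.fst ∪ μ.pointed.completion S :=
      Finset.mem_union_left _ (Finset.mem_image.2 ⟨some i, Finset.mem_map_of_mem _ hi, hio⟩)
    rw [hval]
    have htop : ∀ B', none ∈ B' → μ.pointed.toFun B' = ⊤ := fun B' h => by simp [pointed, h]
    rw [htop _ this, ite_self, top_add, ite_self]
  · intro B g hB hg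
    have himage : (B.map Function.Embedding.some).image f.fst
        = (B.image g).map Function.Embedding.some := by
      ext a
      simp only [Finset.mem_image, Finset.mem_map, Function.Embedding.some_apply]
      constructor
      · rintro ⟨_, ⟨i, hi, rfl⟩, rfl⟩
        exact ⟨g i, ⟨i, hi, rfl⟩, (hg i hi).symm⟩
      · rintro ⟨_, ⟨i, hi, rfl⟩, rfl⟩
        exact ⟨some i, ⟨i, hi, rfl⟩, hg i hi⟩
    rw [hval, Finset.card_map, if_pos hB, if_pos (himg B), himage, Finset.sum_map]
    have h1 : none ∉ (B.image g).map Function.Embedding.some ∪ μ.pointed.completion S := by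
      simp [hnone]
    have h2 : ((B.image g).map Function.Embedding.some ∪ μ.pointed.completion S).eraseNone
        = B.image g ∪ (μ.pointed.completion S).eraseNone := by
      ext a
      simp
    simp only [pointed] at h1 h2 ⊢
    rw [if_neg h1, h2]
    rfl

end ValuatedMatroid

section AssociatedMap

variable {K : Type*} [Field K] (v : AddValuation K (WithTop ℝ))

theorem associatedMap_of_eq_zero {E : Type*} {M : Matrix E E K} {i : E} (h : ∀ j, M i j = 0) :
    (associatedMap v M).fst (some i) = none := by
  simp [associatedMap, h]

theorem Matrix.IsWeaklyMonomial.associatedMap {E : Type*} {M : Matrix E E K}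
    (hM : M.IsWeaklyMonomial) {i j : E} (h : M i j ≠ 0) :
    (associatedMap v M).fst (some i) = some j ∧
      (_root_.associatedMap v M).snd (some i) = v (M i j) := by
  have hex : ∃ j, M i j ≠ 0 := ⟨j, h⟩
  have := hM i _ _ hex.choose_spec h
  simp [_root_.associatedMap, hex, this]

variable {E : Type*} [Fintype E] [DecidableEq E] {r : ℕ} {M : Matrix E E K}

open ValuatedMatroid

/-- Cocircuits of `f⁻¹(μ)` are multiples of images of cocircuits of `μ`. -/
theorem Matrix.IsWeaklyMonomial.isTropComb_cocircuitVec (hM : M.IsWeaklyMonomial)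
    (μ : ValuatedMatroid E r) (A : Finset E) :
    IsTropComb (tropMulVec (M.map v) '' Set.range μ.cocircuitVec)
      ((μ.affinePreimage (_root_.associatedMap v M)).cocircuitVec A) := by
  obtain ⟨X, hXcard, hX, -, hnone, hval⟩ :=
    μ.exists_affinePreimage_eq (_root_.associatedMap v M)
  intro i hi
  -- A single finite coordinate already forces A to have one element less than the rank and to index
  -- nonzero rows only. The whole vector is then a translate of one image.
  suffices h : ∃ A', ∃ c : ℝ, ∀ j, (μ.affinePreimage (_root_.associatedMap v M)).cocircuitVec A j
      = tropMulVec (M.map v) (μ.cocircuitVec A') j + c by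
    obtain ⟨A', c, h⟩ := h
    exact IsTropComb.of_eq_add (Set.mem_image_of_mem _ (Set.mem_range_self A')) h i hi
  set f := _root_.associatedMap v M with hf
  have hiA : i ∉ A := fun h => hi (by simp [cocircuitVec, h])
  rw [cocircuitVec, if_neg hiA] at hi
  have hcard := (μ.affinePreimage f).card_eq hi
  rw [Finset.card_insert_of_notMem hiA] at hcard
  have hne : ∀ a ∈ A, ∃ l, M a l ≠ 0 := by
    intro a ha
    by_contra! h
    exact hi (hnone _ ⟨a, Finset.mem_insert_of_mem ha, associatedMap_of_eq_zero v h⟩)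
  have hne' : ∀ a, ∃ l, a ∈ A → M a l ≠ 0 := fun a => by
    by_cases ha : a ∈ A
    · obtain ⟨l, hl⟩ := hne a ha
      exact ⟨l, fun _ => hl⟩
    · exact ⟨a, fun h => absurd h ha⟩
  choose g hg using hne'
  have hsum : ∑ a ∈ A, f.snd (some a) ≠ ⊤ := by
    refine WithTop.sum_ne_top.2 fun a ha => ?_
    rw [(hM.associatedMap v (hg a ha)).2]
    exact fun h => hg a ha (v.top_iff.1 h)
  obtain ⟨c, hc⟩ := WithTop.ne_top_iff_exists.1 hsum
  -- Here A' = f₁(A) ∪ X and c = ∑_{a ∈ A} f₂(a).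
  refine ⟨A.image g ∪ X, c, fun j => ?_⟩
  by_cases hj : ∃ l, M j l ≠ 0
  swap
  · push Not at hj
    rw [tropMulVec_map_eq_top v hj, top_add, cocircuitVec]
    split_ifs
    · rfl
    · exact hnone _ ⟨j, Finset.mem_insert_self _ _, associatedMap_of_eq_zero v hj⟩
  obtain ⟨l, hl⟩ := hj
  rw [hM.tropMulVec_map v hl]
  by_cases hjA : j ∈ A
  · have : l ∈ A.image g ∪ X := Finset.mem_union_left _ (Finset.mem_image.2
      ⟨j, hjA, hM _ _ _ (hg j hjA) hl⟩)
    simp [cocircuitVec, hjA, this]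
  have hlX := hX j l (hM.associatedMap v hl).1
  -- `g` agrees with f₁ on A only, so its value at j is corrected to l.
  have hins : (insert j A).image (Function.update g j l) ∪ X = insert l (A.image g ∪ X) := by
    rw [Finset.image_insert, Function.update_self, Finset.insert_union]
    congr 2
    exact Finset.image_congr fun a ha => Function.update_of_ne (by rintro rfl; exact hjA ha) _ _
  rw [cocircuitVec, if_neg hjA, hval _ (Function.update g j l)
    (by rw [Finset.card_insert_of_notMem hjA, hcard]), hins, Finset.sum_insert hjA,
    (hM.associatedMap v hl).2, ← hc, cocircuitVec]
  · split_ifs with hlA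
    · rw [Finset.insert_eq_of_mem hlA, μ.top_of_card_ne, top_add, add_top, top_add]
      have h1 := Finset.card_union_le (A.image g) X
      have h2 := Finset.card_image_le (s := A) (f := g)
      omega
    · ac_rfl
  · intro a ha
    rcases Finset.mem_insert.1 ha with rfl | haA
    · rw [Function.update_self]
      exact (hM.associatedMap v hl).1
    · rw [Function.update_of_ne (by rintro rfl; exact hjA haA)]
      exact (hM.associatedMap v (hg a haA)).1

/-- The image of a vector of `μ` satisfies the circuits of `f⁻¹(μ)`. -/
theorem Matrix.IsWeaklyMonomial.minTwice_circuitVec_add (hM : M.IsWeaklyMonomial)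
    (μ : ValuatedMatroid E r) {x : E → WithTop ℝ}
    (hx : ∀ I : Finset E, I.card = r + 1 → MinTwice fun i => μ.circuitVec I i + x i)
    {I : Finset E}
    (hI : I.card = μ.pointed.rk (Finset.univ.image (_root_.associatedMap v M).fst) + 1) :
    MinTwice fun i => (μ.affinePreimage (_root_.associatedMap v M)).circuitVec I i
      + tropMulVec (M.map v) x i := by
  obtain ⟨X, hXcard, hX, hrk, hnone, hval⟩ :=
    μ.exists_affinePreimage_eq (_root_.associatedMap v M)
  set f := _root_.associatedMap v M with hf
  set k := μ.pointed.rk (Finset.univ.image f.fst)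
  refine minTwice_iff.2 fun i hi => ?_
  have hi' := WithTop.add_ne_top.1 hi
  have hiI : i ∈ I := by
    by_contra h
    exact hi'.1 (by simp [circuitVec, h])
  rw [circuitVec, if_pos hiI] at hi'
  -- A zero row a ∈ I would make the finite term at i infinite: through the image coordinate if a =
  -- i, otherwise as a loop in I \ i.
  have hne : ∀ a, ∃ l, a ∈ I → M a l ≠ 0 := by
    intro a
    by_cases ha : ∃ l, M a l ≠ 0
    · obtain ⟨l, hl⟩ := ha
      exact ⟨l, fun _ => hl⟩
    · push Not at ha
      refine ⟨a, fun haI => ?_⟩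
      by_cases hai : a = i
      · exact absurd (hai ▸ tropMulVec_map_eq_top v ha x) hi'.2
      · exact absurd (hnone _ ⟨a, Finset.mem_erase.2 ⟨hai, haI⟩, associatedMap_of_eq_zero v ha⟩)
          hi'.1
  choose g hg using hne
  have hfg : ∀ a ∈ I, f.fst (some a) = some (g a) := fun a ha => (hM.associatedMap v (hg a ha)).1
  -- the terms of the circuit
  have hterm : ∀ a ∈ I, (μ.affinePreimage f).circuitVec I a + tropMulVec (M.map v) x a
      = μ.toFun ((I.erase a).image g ∪ X) + x (g a) + ∑ b ∈ I, f.snd (some b) := by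
    intro a ha
    rw [circuitVec, if_pos ha, hval _ g (by rw [Finset.card_erase_of_mem ha, hI]; rfl)
      (fun b hb => hfg b (Finset.mem_of_mem_erase hb)), hM.tropMulVec_map v (hg a ha),
      ← Finset.add_sum_erase _ _ ha, (hM.associatedMap v (hg a ha)).2]
    ac_rfl
  have hi'' := hi
  simp only [hterm i hiI, WithTop.add_ne_top] at hi''
  obtain ⟨⟨hB, hxi⟩, -⟩ := hi''
  set B := (I.erase i).image g ∪ X with hBdef
  -- All terms share the summand ∑_{b ∈ I} f₂(b), which can be dropped.
  suffices h : ∃ j ∈ I, j ≠ i ∧ μ.toFun ((I.erase j).image g ∪ X) + x (g j)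
      ≤ μ.toFun B + x (g i) by
    obtain ⟨j, hjI, hji, hle⟩ := h
    refine ⟨j, hji, ?_⟩
    simp only [hterm i hiI, hterm j hjI]
    gcongr
  have hBr := μ.card_eq hB
  have hIk : (I.erase i).card = k := by rw [Finset.card_erase_of_mem hiI, hI]; rfl
  have himk : ((I.erase i).image g).card = k := by
    have h1 := Finset.card_union_le ((I.erase i).image g) X
    have h2 := Finset.card_image_le (s := I.erase i) (f := g)
    rw [← hBdef] at h1
    omega
  have hinj : Set.InjOn g (I.erase i) := Finset.card_image_iff.1 (himk.trans hIk.symm)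
  -- If g(i) = g(j) for some j ∈ I \ i, then I \ i and I \ j have the same image and their terms are
  -- equal; g(i) ∈ X is impossible. Otherwise the circuit of μ in B ∪ g(i) provides the second term
  -- m.
  by_cases hgi : g i ∈ B
  · rcases Finset.mem_union.1 hgi with h | h
    · obtain ⟨j, hj, hji⟩ := Finset.mem_image.1 h
      obtain ⟨hne, hjI⟩ := Finset.mem_erase.1 hj
      refine ⟨j, hjI, hne, le_of_eq ?_⟩
      rw [hji, hBdef]
      congr 3
      ext a
      simp only [Finset.mem_image, Finset.mem_erase]
      constructor
      · rintro ⟨b, ⟨-, hb⟩, rfl⟩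
        by_cases hbi : b = i
        · exact ⟨j, ⟨hne, hjI⟩, hbi ▸ hji⟩
        · exact ⟨b, ⟨hbi, hb⟩, rfl⟩
      · rintro ⟨b, ⟨-, hb⟩, rfl⟩
        by_cases hbj : b = j
        · exact ⟨i, ⟨hne.symm, hiI⟩, hbj ▸ hji.symm⟩
        · exact ⟨b, ⟨hbj, hb⟩, rfl⟩
    · exact absurd h (hX i _ (hfg i hiI))
  have hcirc : μ.circuitVec (insert (g i) B) (g i) = μ.toFun B := by
    rw [circuitVec, if_pos (Finset.mem_insert_self _ _), Finset.erase_insert hgi]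
  have hfin : μ.toFun B + x (g i) ≠ ⊤ := WithTop.add_ne_top.2 ⟨hB, hxi⟩
  obtain ⟨m, hm, hle⟩ := minTwice_iff.1 (hx (insert (g i) B)
    (by rw [Finset.card_insert_of_notMem hgi, hBr])) (g i) (by rw [hcirc]; exact hfin)
  rw [hcirc] at hle
  have hmfin := (WithTop.add_ne_top.1 (ne_top_of_le_ne_top hfin hle)).1
  have hmB : m ∈ B := by
    by_contra h
    exact hmfin (by simp [circuitVec, h, hm])
  have hset : (insert (g i) B).erase m = insert (g i) (B.erase m) :=
    Finset.erase_insert_of_ne hm.symm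
  rw [circuitVec, if_pos (Finset.mem_insert_of_mem hmB), hset] at hle hmfin
  have hgi' : g i ∉ (I.erase i).image g := fun h => hgi (Finset.mem_union_left _ h)
  rcases Finset.mem_union.1 hmB with h | h
  · obtain ⟨j, hj, rfl⟩ := Finset.mem_image.1 h
    obtain ⟨hne, hjI⟩ := Finset.mem_erase.1 hj
    refine ⟨j, hjI, hne, ?_⟩
    convert hle using 3
    have hjX := hX j _ (hfg j hjI)
    rw [hBdef, Finset.erase_union_distrib, Finset.erase_eq_of_notMem hjX, ← Finset.insert_union]
    congr 1
    ext a
    simp only [Finset.mem_image, Finset.mem_erase, Finset.mem_insert]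
    constructor
    · rintro ⟨b, ⟨hbj, hb⟩, rfl⟩
      by_cases hbi : b = i
      · exact Or.inl (by rw [hbi])
      · exact Or.inr ⟨fun h => hbj (hinj (Finset.mem_coe.2 (Finset.mem_erase.2 ⟨hbi, hb⟩))
          (Finset.mem_coe.2 hj) h), b, ⟨hbi, hb⟩, rfl⟩
    · rintro (rfl | ⟨hgj, b, ⟨-, hb⟩, rfl⟩)
      · exact ⟨i, ⟨hne.symm, hiI⟩, rfl⟩
      · exact ⟨b, ⟨fun h => hgj (by rw [h]), hb⟩, rfl⟩
  -- If m were in X, a basis of μ would contain g(I), which has k + 1 elements in the image of f₁,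
  -- exceeding its rank k.
  · have hle' := hrk (insert (g i) ((I.erase i).image g)) _ (fun l hl => by
      rcases Finset.mem_insert.1 hl with rfl | hl
      · exact ⟨i, hfg i hiI⟩
      · obtain ⟨b, hb, rfl⟩ := Finset.mem_image.1 hl
        exact ⟨b, hfg b (Finset.mem_of_mem_erase hb)⟩) hmfin
      (Finset.insert_subset_insert _ fun l hl => Finset.mem_erase.2 ⟨by
        rintro rfl
        obtain ⟨b, hb, hbl⟩ := Finset.mem_image.1 hl
        exact hX b _ (hfg b (Finset.mem_of_mem_erase hb)) (hbl ▸ h),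
        Finset.mem_union_left _ hl⟩)
    rw [Finset.card_insert_of_notMem hgi', himk] at hle'
    omega

/-- The image of a tropical linear space is the tropical linear space of the affine induced
valuated matroid. -/
theorem Matrix.IsWeaklyMonomial.trop_affinePreimage (hM : M.IsWeaklyMonomial)
    (μ : ValuatedMatroid E r) :
    (μ.affinePreimage (_root_.associatedMap v M)).trop = tropImage (M.map v) μ.trop := by
  rw [trop_eq_tropSpan μ, tropImage_tropSpan]
  refine Set.Subset.antisymm ?_ ?_
  · rw [trop_eq_tropSpan]
    exact tropSpan_subset (Set.forall_mem_range.2 (hM.isTropComb_cocircuitVec v μ))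
  · rw [tropSpan_subset_trop_iff]
    rintro _ ⟨_, ⟨A, rfl⟩, rfl⟩ I hI
    exact hM.minTwice_circuitVec_add v μ
      (fun J hJ => μ.minTwice_circuitVec_add_cocircuitVec A hJ) hI

end AssociatedMap

/-! ### Tropical Plücker relations and the quiver Dressian -/

section QuiverDressian

variable {K : Type*} [Field K] (v : AddValuation K (WithTop ℝ)) {n r s : ℕ}

open MvPolynomial

/-- With distinct exponents and nonzero coefficients no terms merge or vanish, so the support of the
polynomial can be replaced by the index set T. -/
theorem tropVanishes_sum_monomial_iff {σ τ : Type*} {T : Finset τ} {e : τ → σ →₀ ℕ} {c : τ → K}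
    (he : Set.InjOn e T) (hc : ∀ t ∈ T, c t ≠ 0) {x : σ → WithTop ℝ} :
    TropVanishes v (∑ t ∈ T, monomial (e t) (c t)) x ↔
      ∀ t ∈ T, v (c t) + (e t).sum (fun i k => k • x i) ≠ ⊤ → ∃ t' ∈ T, t' ≠ t ∧
        v (c t') + (e t').sum (fun i k => k • x i) ≤ v (c t) + (e t).sum fun i k => k • x i := by
  classical
  set F := ∑ t ∈ T, monomial (e t) (c t) with hF
  have hcoeff : ∀ t ∈ T, F.coeff (e t) = c t := by
    intro t ht
    rw [hF, coeff_sum, Finset.sum_eq_single_of_mem t ht fun t' ht' hne => ?_, coeff_monomial,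
      if_pos rfl]
    rw [coeff_monomial, if_neg fun h => hne (he ht' ht h)]
  have hsupp : ∀ u ∈ F.support, ∃ t ∈ T, e t = u := by
    intro u hu
    by_contra! h
    rw [mem_support_iff, hF, coeff_sum] at hu
    exact hu (Finset.sum_eq_zero fun t ht => by rw [coeff_monomial, if_neg (h t ht)])
  have hmem : ∀ t ∈ T, e t ∈ F.support := fun t ht => by
    rw [mem_support_iff, hcoeff t ht]
    exact hc t ht
  rw [TropVanishes, minTwice_iff]
  constructor
  · intro h t ht hfin
    obtain ⟨⟨u, hu⟩, hne, hle⟩ := h ⟨e t, hmem t ht⟩ (by simpa only [hcoeff t ht] using hfin)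
    obtain ⟨t', ht', rfl⟩ := hsupp u hu
    simp only [hcoeff t ht, hcoeff t' ht'] at hle
    exact ⟨t', ht', fun h => hne (Subtype.ext (congrArg e h)), hle⟩
  · rintro h ⟨u, hu⟩ hfin
    obtain ⟨t, ht, rfl⟩ := hsupp u hu
    simp only [hcoeff t ht] at hfin
    obtain ⟨t', ht', hne, hle⟩ := h t ht hfin
    refine ⟨⟨e t', hmem t' ht'⟩, fun h => hne (he ht' ht (congrArg Subtype.val h)), ?_⟩
    simpa only [hcoeff t ht, hcoeff t' ht'] using hle

theorem sum_single_add_single_nsmul {σ : Type*} (a b : σ) (x : σ → WithTop ℝ) :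
    (Finsupp.single a 1 + Finsupp.single b 1 : σ →₀ ℕ).sum (fun i k => k • x i) = x a + x b := by
  classical
  rw [Finsupp.sum_add_index' (h := fun i k => k • x i) (fun _ => zero_nsmul _)
      (fun _ _ _ => add_nsmul _ _ _),
    Finsupp.sum_single_index (h := fun i k => k • x i) (zero_nsmul _),
    Finsupp.sum_single_index (h := fun i k => k • x i) (zero_nsmul _),
    one_nsmul, one_nsmul]

theorem single_add_single_eq_iff {σ : Type*} {a b c d : σ} :
    (Finsupp.single a 1 + Finsupp.single b 1 : σ →₀ ℕ) = Finsupp.single c 1 + Finsupp.single d 1 →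
      a = c ∧ b = d ∨ a = d ∧ b = c := by
  classical
  intro h
  have h' := congrArg Finsupp.toMultiset h
  simp only [map_add, Finsupp.toMultiset_single, one_smul] at h'
  have h'' : s(a, b) = s(c, d) := Sym2.eq_iff.2 ?_
  · exact Sym2.eq_iff.1 h''
  · have ha : a ∈ ({c} + {d} : Multiset σ) := h' ▸ by simp
    simp only [Multiset.mem_add, Multiset.mem_singleton] at ha
    rcases ha with rfl | rfl
    · exact Or.inl ⟨rfl, Multiset.singleton_inj.1 (add_left_cancel h')⟩
    · rw [add_comm ({c} : Multiset σ)] at h'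
      exact Or.inr ⟨rfl, Multiset.singleton_inj.1 (add_left_cancel h')⟩

theorem pluckerSign_cast (i j : Fin n) (I J : Finset (Fin n)) :
    ((pluckerSign i j I J : ℤ) : K) ≠ 0 ∧ v ((pluckerSign i j I J : ℤ) : K) = 0 := by
  rcases neg_one_pow_eq_or ℤ ((J.filter fun j' => i < j').card
    + (I.filter fun i' => j < i').card) with h | h <;>
  simp [pluckerSign, h, v.map_neg]

/-- The Grassmann-Plücker relations hold tropically at every valuated matroid. -/
theorem ValuatedMatroid.tropVanishes_grassmannPlucker (μ : ValuatedMatroid (Fin n) r)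
    {x : {B : Finset (Fin n) // B.card = r} → WithTop ℝ} {c : ℝ}
    (hx : ∀ B, x B = μ.toFun B.1 + c)
    {F : MvPolynomial {B : Finset (Fin n) // B.card = r} K} (hF : F ∈ grassmannPlucker K n r) :
    TropVanishes v F x := by
  classical
  obtain ⟨I, J, hI, hJ, rfl⟩ := hF
  have hcI : ∀ j ∈ J \ I, (insert j I).card = r := fun j hj => by
    rw [Finset.card_insert_of_notMem (Finset.mem_sdiff.1 hj).2, hI]
  have hcJ : ∀ j ∈ J \ I, (J.erase j).card = r := fun j hj => by
    rw [Finset.card_erase_of_mem (Finset.mem_sdiff.1 hj).1, hJ, Nat.add_sub_cancel]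
  by_cases hsmall : (J \ I).card = 2
  · -- the relation is trivial
    obtain ⟨a, b, hab, hJI⟩ := Finset.card_eq_two.1 hsmall
    wlog hlt : a < b generalizing a b
    · exact this b a hab.symm (hJI.trans (Finset.pair_comm a b))
        (lt_of_le_of_ne (not_lt.1 hlt) hab.symm)
    have ha : a ∈ J \ I := hJI ▸ Finset.mem_insert_self _ _
    have hb : b ∈ J \ I := hJI ▸ Finset.mem_insert_of_mem (Finset.mem_singleton_self _)
    have hIJ : I ⊆ J := by
      have h1 := Finset.card_sdiff_add_card_inter J I
      have h2 : J ∩ I = I := Finset.eq_of_subset_of_card_le Finset.inter_subset_right (by omega)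
      exact h2 ▸ Finset.inter_subset_left
    have hJ' : J = insert a (insert b I) := by
      rw [← Finset.sdiff_union_of_subset hIJ, hJI]
      ext; simp
    rw [Finset.mem_sdiff] at ha hb
    have ha' : a ∉ insert b I := by simp [hab, ha.2]
    have e₁ : J.erase a = insert b I := by rw [hJ', Finset.erase_insert ha']
    have e₂ : J.erase b = insert a I := by
      rw [hJ', Finset.erase_insert_of_ne hab, Finset.erase_insert hb.2]
    -- Both terms are multiples of p_{I ∪ a} p_{I ∪ b}. As a < b, the element b is counted above a
    -- in J but not in I, so the exponent at a is odd; the one at b is even, and the terms cancel.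
    have s₁ : pluckerSign a a I J = -1 := by
      have : (J.filter fun j => a < j).card = (I.filter fun j => a < j).card + 1 := by
        rw [hJ', Finset.filter_insert, if_neg (lt_irrefl a), Finset.filter_insert, if_pos hlt,
          Finset.card_insert_of_notMem (by simp [hb.2])]
      rw [pluckerSign, this]
      exact Odd.neg_one_pow ⟨(I.filter fun j => a < j).card, by ring⟩
    have s₂ : pluckerSign b b I J = 1 := by
      have : (J.filter fun j => b < j).card = (I.filter fun j => b < j).card := by
        rw [hJ', Finset.filter_insert, if_neg hlt.le.not_gt, Finset.filter_insert,
          if_neg (lt_irrefl b)]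
      rw [pluckerSign, this]
      exact Even.neg_one_pow ⟨_, rfl⟩
    have hzero : ∑ j ∈ J \ I, C ((pluckerSign j j I J : ℤ) : K) * pluckerVar K r (insert j I)
        * pluckerVar K r (J.erase j) = 0 := by
      rw [hJI, Finset.sum_pair hab, e₁, e₂, s₁, s₂]
      simp only [Int.cast_neg, Int.cast_one, map_neg, map_one]
      ring
    rw [hzero]
    exact Or.inl fun u => absurd u.2 (by simp)
  have hcard : 2 < (J \ I).card := by
    have h1 := Finset.le_card_sdiff I J
    omega
  let e : {j // j ∈ J \ I} → ({B : Finset (Fin n) // B.card = r} →₀ ℕ) := fun j =>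
    Finsupp.single ⟨insert j.1 I, hcI _ j.2⟩ 1 + Finsupp.single ⟨J.erase j.1, hcJ _ j.2⟩ 1
  have hsum : ∑ j ∈ J \ I, C ((pluckerSign j j I J : ℤ) : K) * pluckerVar K r (insert j I)
        * pluckerVar K r (J.erase j)
      = ∑ j ∈ (J \ I).attach, monomial (e j) ((pluckerSign j.1 j.1 I J : ℤ) : K) := by
    rw [← Finset.sum_attach]
    refine Finset.sum_congr rfl fun j _ => ?_
    rw [pluckerVar, dif_pos (hcI _ j.2), pluckerVar, dif_pos (hcJ _ j.2), X, X, C_mul_monomial,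
      monomial_mul, mul_one, mul_one]
  have hinj : Function.Injective e := by
    intro j k hjk
    have hj := Finset.mem_sdiff.1 j.2
    have hk := Finset.mem_sdiff.1 k.2
    rcases single_add_single_eq_iff hjk with ⟨h, -⟩ | ⟨h, -⟩
    · have h' : insert j.1 I = insert k.1 I := Subtype.ext_iff.1 h
      have : j.1 ∈ insert k.1 I := h' ▸ Finset.mem_insert_self _ _
      exact Subtype.ext ((Finset.mem_insert.1 this).resolve_right hj.2)
    · exfalso
      have h' : insert j.1 I = J.erase k.1 := Subtype.ext_iff.1 h
      -- A third element of J \ I lies in J \ k but not in I ∪ j, so these sets differ and no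
      -- monomial occurs twice.
      obtain ⟨l, hl, hlj, hlk⟩ : ∃ l ∈ J \ I, l ≠ j.1 ∧ l ≠ k.1 := by
        obtain ⟨l, hl⟩ : ((J \ I) \ {j.1, k.1}).Nonempty := by
          rw [← Finset.card_pos]
          have h1 := Finset.le_card_sdiff ({j.1, k.1} : Finset (Fin n)) (J \ I)
          have h2 := Finset.card_le_two (a := j.1) (b := k.1)
          omega
        simp only [Finset.mem_sdiff, Finset.mem_insert, Finset.mem_singleton, not_or] at hl
        exact ⟨l, Finset.mem_sdiff.2 hl.1, hl.2⟩
      rw [Finset.mem_sdiff] at hl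
      have : l ∈ insert j.1 I := h' ▸ Finset.mem_erase.2 ⟨hlk, hl.1⟩
      exact ((Finset.mem_insert.1 this).resolve_left hlj |> hl.2)
  rw [hsum, tropVanishes_sum_monomial_iff v hinj.injOn fun j _ => (pluckerSign_cast v _ _ _ _).1]
  rintro j - hfin
  simp only [e, sum_single_add_single_nsmul, (pluckerSign_cast v _ _ _ _).2, zero_add, hx]
    at hfin ⊢
  have hval : ∀ j : {j // j ∈ J \ I}, μ.circuitVec J j.1 + μ.cocircuitVec I j.1
      = μ.toFun (insert j.1 I) + μ.toFun (J.erase j.1) := fun j => by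
    rw [circuitVec, cocircuitVec, if_pos (Finset.mem_sdiff.1 j.2).1,
      if_neg (Finset.mem_sdiff.1 j.2).2, add_comm]
  have hfin' : μ.circuitVec J j.1 + μ.cocircuitVec I j.1 ≠ ⊤ := by
    rw [hval]
    simp only [WithTop.add_ne_top] at hfin ⊢
    exact ⟨hfin.1.1, hfin.2.1⟩
  obtain ⟨k, hkj, hle⟩ := minTwice_iff.1 (μ.minTwice_circuitVec_add_cocircuitVec I hJ) j.1 hfin'
  have hk := ne_top_of_le_ne_top hfin' hle
  have hkJ : k ∈ J \ I := by
    rw [WithTop.add_ne_top] at hk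
    refine Finset.mem_sdiff.2 ⟨?_, fun h => ?_⟩
    · by_contra h
      exact hk.1 (by simp [circuitVec, h])
    · exact hk.2 (by simp [cocircuitVec, h])
  refine ⟨⟨k, hkJ⟩, Finset.mem_attach _ _, fun h => hkj (congrArg Subtype.val h), ?_⟩
  rw [hval, hval ⟨k, hkJ⟩] at hle
  rw [add_add_add_comm, add_add_add_comm (μ.toFun (insert j.1 I))]
  gcongr

/-- The quiver Plücker relation of `I` and `J` holds tropically at `μ` and `ν` if and only if the
image of a cocircuit of `μ` is orthogonal to a circuit of `ν`. -/
theorem Matrix.IsWeaklyMonomial.tropVanishes_iff {M : Matrix (Fin n) (Fin n) K}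
    (hM : M.IsWeaklyMonomial) (μ : ValuatedMatroid (Fin n) r) (ν : ValuatedMatroid (Fin n) s)
    {x : {B : Finset (Fin n) // B.card = r} → WithTop ℝ}
    {y : {B : Finset (Fin n) // B.card = s} → WithTop ℝ} {c d : ℝ}
    (hx : ∀ B, x B = μ.toFun B.1 + c) (hy : ∀ B, y B = ν.toFun B.1 + d)
    {I J : Finset (Fin n)} (hI : I.card + 1 = r) (hJ : J.card = s + 1) :
    TropVanishes v (∑ j ∈ Iᶜ, ∑ i ∈ J, C (((pluckerSign i j I J : ℤ) : K) * M i j) *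
      rename Sum.inl (pluckerVar K r (insert j I)) *
      rename Sum.inr (pluckerVar K s (J.erase i))) (Sum.elim x y) ↔
    MinTwice fun i => ν.circuitVec J i + tropMulVec (M.map v) (μ.cocircuitVec I) i := by
  classical
  -- Only pairs (j, i) with M_{ij} ≠ 0 give monomials. By weak monomiality each row i occurs at most
  -- once, so the terms of the relation match the finite terms of the orthogonality condition.
  let T := (Iᶜ ×ˢ J).filter fun t => M t.2 t.1 ≠ 0
  have hT : ∀ t, t ∈ T ↔ (t.1 ∉ I ∧ t.2 ∈ J) ∧ M t.2 t.1 ≠ 0 := fun t => by simp [T]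
  have hcI : ∀ t ∈ T, (insert t.1 I).card = r := fun t ht => by
    rw [Finset.card_insert_of_notMem ((hT t).1 ht).1.1, hI]
  have hcJ : ∀ t ∈ T, (J.erase t.2).card = s := fun t ht => by
    rw [Finset.card_erase_of_mem ((hT t).1 ht).1.2, hJ, Nat.add_sub_cancel]
  let e : {t // t ∈ T} → ({B : Finset (Fin n) // B.card = r} ⊕
      {B : Finset (Fin n) // B.card = s} →₀ ℕ) := fun t =>
    Finsupp.single (Sum.inl ⟨insert t.1.1 I, hcI _ t.2⟩) 1 +
      Finsupp.single (Sum.inr ⟨J.erase t.1.2, hcJ _ t.2⟩) 1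
  have hsum : ∑ j ∈ Iᶜ, ∑ i ∈ J, C (((pluckerSign i j I J : ℤ) : K) * M i j) *
      rename Sum.inl (pluckerVar K r (insert j I)) * rename Sum.inr (pluckerVar K s (J.erase i))
      = ∑ t ∈ T.attach,
        monomial (e t) (((pluckerSign t.1.2 t.1.1 I J : ℤ) : K) * M t.1.2 t.1.1) := by
    rw [← Finset.sum_product', ← Finset.sum_filter_of_ne (p := fun t => M t.2 t.1 ≠ 0)
      (fun t _ h h0 => h (by simp [h0])), ← Finset.sum_attach]
    refine Finset.sum_congr rfl fun t _ => ?_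
    rw [pluckerVar, dif_pos (hcI _ t.2), pluckerVar, dif_pos (hcJ _ t.2), rename_X, rename_X,
      X, X, C_mul_monomial, monomial_mul, mul_one, mul_one]
  -- The variables p and q are separate, so a monomial p_{I ∪ j} q_{J \ i} determines j and i.
  have hinj : Function.Injective e := by
    rintro ⟨⟨j, i⟩, ht⟩ ⟨⟨j', i'⟩, ht'⟩ h
    have h₁ := (hT _).1 ht
    have h₂ := (hT _).1 ht'
    rcases single_add_single_eq_iff h with ⟨h, h'⟩ | ⟨h, -⟩
    · have h3 : insert j I = insert j' I := Subtype.ext_iff.1 (Sum.inl_injective h)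
      have h4 : J.erase i = J.erase i' := Subtype.ext_iff.1 (Sum.inr_injective h')
      have hj : j ∈ insert j' I := h3 ▸ Finset.mem_insert_self _ _
      have hj' : j = j' := (Finset.mem_insert.1 hj).resolve_right h₁.1.1
      have hi' : i = i' := by
        by_contra hne
        have : i ∈ J.erase i := h4 ▸ Finset.mem_erase.2 ⟨hne, h₁.1.2⟩
        exact Finset.notMem_erase _ _ this
      subst hj' hi'
      rfl
    · exact absurd h Sum.inl_ne_inr
  have hne : ∀ t ∈ T, ((pluckerSign t.2 t.1 I J : ℤ) : K) * M t.2 t.1 ≠ 0 := fun t ht =>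
    mul_ne_zero (pluckerSign_cast v _ _ _ _).1 ((hT t).1 ht).2
  have hval : ∀ t ∈ T, ν.circuitVec J t.2 + tropMulVec (M.map v) (μ.cocircuitVec I) t.2
      = v (M t.2 t.1) + (μ.toFun (insert t.1 I) + ν.toFun (J.erase t.2)) := by
    intro t ht
    have h := (hT t).1 ht
    rw [hM.tropMulVec_map v h.2, ValuatedMatroid.circuitVec, ValuatedMatroid.cocircuitVec,
      if_pos h.1.2, if_neg h.1.1]
    ac_rfl
  have hex : ∀ i, ν.circuitVec J i + tropMulVec (M.map v) (μ.cocircuitVec I) i ≠ ⊤ →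
      ∃ j, (j, i) ∈ T := by
    intro i hi
    rw [WithTop.add_ne_top] at hi
    have hiJ : i ∈ J := by
      by_contra h
      exact hi.1 (by simp [ValuatedMatroid.circuitVec, h])
    obtain ⟨j, hj⟩ : ∃ j, M i j ≠ 0 := by
      by_contra! h
      exact hi.2 (tropMulVec_map_eq_top v h _)
    refine ⟨j, (hT _).2 ⟨⟨fun h => hi.2 ?_, hiJ⟩, hj⟩⟩
    rw [hM.tropMulVec_map v hj]
    simp [ValuatedMatroid.cocircuitVec, h]
  have hterm : ∀ t : {t // t ∈ T}, v (((pluckerSign t.1.2 t.1.1 I J : ℤ) : K) * M t.1.2 t.1.1) +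
      (e t).sum (fun i k => k • Sum.elim x y i)
      = ν.circuitVec J t.1.2 + tropMulVec (M.map v) (μ.cocircuitVec I) t.1.2 + (c + d : ℝ) := by
    intro t
    rw [hval t.1 t.2, sum_single_add_single_nsmul, v.map_mul, (pluckerSign_cast v _ _ _ _).2,
      zero_add, Sum.elim_inl, Sum.elim_inr, hx, hy, WithTop.coe_add]
    ac_rfl
  rw [hsum, tropVanishes_sum_monomial_iff v hinj.injOn fun t _ => hne t.1 t.2, minTwice_iff]
  simp only [hterm]
  constructor
  · intro h i hi
    obtain ⟨j, hj⟩ := hex i hi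
    obtain ⟨⟨t, ht⟩, -, htne, hle⟩ := h ⟨(j, i), hj⟩ (Finset.mem_attach _ _)
      (WithTop.add_ne_top.2 ⟨hi, WithTop.coe_ne_top⟩)
    refine ⟨t.2, fun h => htne (Subtype.ext (Prod.ext ?_ h)),
      (WithTop.add_le_add_iff_right WithTop.coe_ne_top).1 hle⟩
    -- Two terms in the same row i would have the same j, hence be the same term.
    exact hM i _ _ (h ▸ ((hT t).1 ht).2) ((hT _).1 hj).2
  · rintro h t - hfin
    obtain ⟨i, hi, hle⟩ := h t.1.2 (WithTop.add_ne_top.1 hfin).1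
    obtain ⟨j, hj⟩ := hex i (ne_top_of_le_ne_top (WithTop.add_ne_top.1 hfin).1 hle)
    exact ⟨⟨(j, i), hj⟩, Finset.mem_attach _ _,
      fun h => hi (congrArg (fun t => t.1.2) h), by gcongr⟩

/-- The containment is tested on images of cocircuits of μ against circuits of ν. The constants
allow arbitrary representatives of the projective points. -/
theorem Matrix.IsWeaklyMonomial.tropContainment_iff {M : Matrix (Fin n) (Fin n) K}
    (hM : M.IsWeaklyMonomial) (μ : ValuatedMatroid (Fin n) r) (ν : ValuatedMatroid (Fin n) s)
    {x : {B : Finset (Fin n) // B.card = r} → WithTop ℝ}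
    {y : {B : Finset (Fin n) // B.card = s} → WithTop ℝ} {c d : ℝ}
    (hx : ∀ B, x B = μ.toFun B.1 + c) (hy : ∀ B, y B = ν.toFun B.1 + d) :
    TropContainment v M μ ν ↔
      ∀ F ∈ quiverPlucker M r s, TropVanishes v F (Sum.elim x y) := by
  rw [TropContainment, μ.trop_eq_tropSpan, tropImage_tropSpan,
    ValuatedMatroid.tropSpan_subset_trop_iff]
  constructor
  · rintro h _ ⟨I, J, hI, hJ, rfl⟩
    exact (hM.tropVanishes_iff v μ ν hx hy hI hJ).2
      (h _ (Set.mem_image_of_mem _ (Set.mem_range_self I)) J hJ)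
  · rintro h _ ⟨_, ⟨I, rfl⟩, rfl⟩ J hJ
    by_cases hI : I.card + 1 = r
    · exact (hM.tropVanishes_iff v μ ν hx hy hI hJ).1 (h _ ⟨I, J, hI, hJ, rfl⟩)
    -- Sets I of the wrong size index no relation, but their cocircuit vectors are constantly ∞.
    · refine Or.inl fun i => ?_
      have : ∀ j, μ.cocircuitVec I j = ⊤ := fun j => by
        rw [ValuatedMatroid.cocircuitVec]
        split_ifs with hj
        · rfl
        · exact μ.top_of_card_ne _ (by rwa [Finset.card_insert_of_notMem hj])
      have htop : tropMulVec (M.map v) (μ.cocircuitVec I) i = ⊤ :=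
        top_le_iff.1 (le_tropMulVec _ fun j => by rw [this j, add_top])
      simp only [htop, add_top]

theorem mem_quiverDressian_iff {V : Type*} [Quiver V]
    {M : ∀ ⦃i j : V⦄, (i ⟶ j) → Matrix (Fin n) (Fin n) K}
    (hM : ∀ ⦃i j : V⦄ (α : i ⟶ j), (M α).IsWeaklyMonomial) {d : V → ℕ}
    (μ : ∀ i, ValuatedMatroid (Fin n) (d i)) :
    (fun i => (μ i).point) ∈ quiverDressian v M d ↔
      ∀ ⦃i j : V⦄ (α : i ⟶ j), TropContainment v (M α) (μ i) (μ j) := by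
  constructor
  · rintro ⟨x, hx, -, h⟩ i j α
    have hx' : ∀ i, ∃ c : ℝ, ∀ B, (x i).1 B = (μ i).toFun B.1 + c := fun i =>
      TropVec.mk_eq_iff.1 (hx i).symm
    obtain ⟨c, hc⟩ := hx' i
    obtain ⟨c', hc'⟩ := hx' j
    exact ((hM α).tropContainment_iff v (μ i) (μ j) hc hc').2 (h α)
  · intro h
    have h0 : ∀ i (B : {B : Finset (Fin n) // B.card = d i}),
        (μ i).toFun B.1 = (μ i).toFun B.1 + ((0 : ℝ) : WithTop ℝ) := by simp
    refine ⟨_, fun i => rfl, fun i F hF => ?_, fun i j α => ?_⟩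
    · exact (μ i).tropVanishes_grassmannPlucker v (h0 i) hF
    · exact ((hM α).tropContainment_iff v (μ i) (μ j) (h0 i) (h0 j)).1 (h α)

end QuiverDressian

/-! ### Assembling the theorem -/

section Main

variable {K : Type*} [Field K] (v : AddValuation K (WithTop ℝ)) {n r s : ℕ}

theorem Matrix.IsWeaklyMonomial.tropContainment_iff_isAffineMorphism
    {M : Matrix (Fin n) (Fin n) K} (hM : M.IsWeaklyMonomial) (μ : ValuatedMatroid (Fin n) r)
    (ν : ValuatedMatroid (Fin n) s) :
    TropContainment v M μ ν ↔ (_root_.associatedMap v M).IsAffineMorphism ν μ := by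
  rw [TropContainment, ← hM.trop_affinePreimage v μ, ValuatedMatroid.trop_subset_trop_iff]
  rfl

theorem Matrix.IsWeaklyMonomial.isRealizableContainment_iff
    {M : Matrix (Fin n) (Fin n) K} (hM : M.IsWeaklyMonomial) (μ : ValuatedMatroid (Fin n) r)
    (ν : ValuatedMatroid (Fin n) s) :
    IsRealizableContainment v M μ ν ↔
      IsRealizableAffineMorphism v (_root_.associatedMap v M) ν μ := by
  simp only [IsRealizableContainment, IsRealizableAffineMorphism, IsRealizableQuotient,
    IsRealizable, ← hM.trop_affinePreimage v μ, ← realizes_iff]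
  constructor
  · rintro ⟨hU, L₁, L₂, hL, h₁, h₂⟩
    -- After the rewriting, both sides ask for the same L₁ ≤ L₂; the quotient condition follows by
    -- tropicalizing this inclusion.
    have hq : (μ.affinePreimage (_root_.associatedMap v M)).IsQuotient ν := by
      rw [← ValuatedMatroid.trop_subset_trop_iff, ← h₁.tropSubspace_eq, ← h₂.tropSubspace_eq]
      exact tropSubspace_mono hL
    exact ⟨⟨L₂, h₂⟩, hU, hq, ⟨L₁, h₁⟩, hq, L₁, L₂, hL, h₁, h₂⟩
  · rintro ⟨-, hU, -, -, -, h⟩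
    exact ⟨hU, h⟩

theorem Matrix.IsWeaklyMonomial.isRealizableContainment_of_map_le
    {M : Matrix (Fin n) (Fin n) K} (hM : M.IsWeaklyMonomial) {μ : ValuatedMatroid (Fin n) r}
    {ν : ValuatedMatroid (Fin n) s} {U W : Submodule K (Fin n → K)}
    (hU : tropSubspace v U = μ.trop) (hW : tropSubspace v W = ν.trop)
    (h : U.map M.mulVecLin ≤ W) : IsRealizableContainment v M μ ν :=
  ⟨⟨U, hU⟩, U.map M.mulVecLin, W, h, by rw [hM.tropSubspace_map v, hU], hW⟩

end Main

theorem theoremB {K : Type*} [Field K] (v : AddValuation K (WithTop ℝ)) (n : ℕ) :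
    (∀ (M : Matrix (Fin n) (Fin n) K), M.IsWeaklyMonomial →
      ∀ (r s : ℕ) (μ : ValuatedMatroid (Fin n) r) (ν : ValuatedMatroid (Fin n) s),
        (TropContainment v M μ ν ↔ (associatedMap v M).IsAffineMorphism ν μ) ∧
        (IsRealizableContainment v M μ ν ↔
          IsRealizableAffineMorphism v (associatedMap v M) ν μ) ∧
        ((∃ U W : Submodule K (Fin n → K), tropSubspace v U = μ.trop ∧
            tropSubspace v W = ν.trop ∧ U.map M.mulVecLin ≤ W) →
          IsRealizableContainment v M μ ν)) ∧
    (∀ {V : Type*} [Quiver V] [Finite V] [∀ i j : V, Finite (i ⟶ j)]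
      (M : ∀ ⦃i j : V⦄, (i ⟶ j) → Matrix (Fin n) (Fin n) K),
      (∀ ⦃i j : V⦄ (α : i ⟶ j), (M α).IsWeaklyMonomial) →
      ∀ (d : V → ℕ) (μ : ∀ i, ValuatedMatroid (Fin n) (d i)),
        [(fun i => (μ i).point) ∈ quiverDressian v M d,
          ∀ ⦃i j : V⦄ (α : i ⟶ j), TropContainment v (M α) (μ i) (μ j),
          ∀ ⦃i j : V⦄ (α : i ⟶ j),
            (associatedMap v (M α)).IsAffineMorphism (μ j) (μ i)].TFAE) := by
  refine ⟨fun M hM r s μ ν => ⟨hM.tropContainment_iff_isAffineMorphism v μ ν,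
    hM.isRealizableContainment_iff v μ ν, ?_⟩, fun M hM d μ => ?_⟩
  · rintro ⟨U, W, hU, hW, h⟩
    exact hM.isRealizableContainment_of_map_le v hU hW h
  · tfae_have 1 ↔ 2 := mem_quiverDressian_iff v hM μ
    tfae_have 2 ↔ 3 := by
      simp only [fun i j (α : i ⟶ j) =>
        (hM α).tropContainment_iff_isAffineMorphism v (μ i) (μ j)]
    tfae_finish
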